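/- Let $(\Omega,\mathcal F,\mathbb P)$ be a probability space and let $\mathfrak X$ be a family of real random variables on it with $\mathbb E[X]=0$ and $\mathbb E[X^2]=1$ for every $X\in\mathfrak X$. Assume that $\mathfrak X$ has finite bracketing numbers in $L_2(\mathbb P)$: for every $\varepsilon>0$ there are finitely many pairs $(l_k,u_k)$ of random variables in $L_2(\mathbb P)$ with $\|u_k-l_k\|_{L_2(\mathbb P)}\le\varepsilon$ such that each $X\in\mathfrak X$ satisfies $l_k\le X\le u_k$ (pointwise) for some $k$. Let $\omega_1,\dots,\omega_n$ be independent draws from $\mathbb P$ (the coordinates of $\Omega^n$ under $\mathbb P^{\otimes n}$), let $X^{(j)}=X(\omega_j)$, $j=1,\dots,n$, be the resulting i.i.d. copies of $X\in\mathfrak X$, and put $$\mathbb E_n[X]=\frac1n\sum_{j=1}^n X^{(j)},\qquad V_n(X)=\frac1n\sum_{j=1}^n\bigl(X^{(j)}\bigr)^2,\qquad W_n(X)=\frac{\mathbb E_n[X]}{\sqrt{V_n(X)}}\quad(0/0:=0).$$ Suppose that for some constant $0<\mathfrak C<\infty$ $$\limsup_{n\to\infty}\mathbb E\Bigl[\sup_{X\in\mathfrak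 X}\bigl|\sqrt n\,\mathbb E_n[X]\bigr|\Bigr]\le\mathfrak C .$$ Then for any $\kappa>0$ and $\alpha>\sqrt2$ there exist $\theta>0$ and a positive integer $n_0$ (depending on $\mathfrak X$, $\mathfrak C$, $\alpha$ and $\kappa$) such that for all $n\ge n_0$ and all $x\in[0,\theta\sqrt n]$ $$\mathbb P\Bigl(\sup_{X\in\mathfrak X}\bigl|\sqrt n\,W_n(X)\bigr|\ge x+\alpha\,\mathfrak C\Bigr)\le 2\exp\Bigl(-\frac{x^2}{4\alpha^2(1+\kappa)}\Bigr).$$ (If the suprema are not measurable, $\mathbb E$ of the supremum and $\mathbb P$ of the event are the outer expectation and the outer probability; suprema over an empty family are $0$.) -/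

import Mathlib

open MeasureTheory Filter
open scoped ENNReal

noncomputable section

namespace SelfNormalized

/-- Outer expectation `E* f` of a `[0, ∞]`-valued, possibly non-measurable function: the infimum of
the expectations of its measurable majorants. -/
def outerExpectation {S : Type*} [MeasurableSpace S] (Q : Measure S) (f : S → ℝ≥0∞) : ℝ≥0∞ :=
  ⨅ (g : S → ℝ≥0∞) (_ : Measurable g) (_ : ∀ s, f s ≤ g s), ∫⁻ s, g s ∂Q

/-- For measurable functions the outer expectation is the usual expectation. -/
theorem outerExpectation_eq_lintegral {S : Type*} [MeasurableSpace S] (Q : Measure S)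
    {f : S → ℝ≥0∞} (hf : Measurable f) : outerExpectation Q f = ∫⁻ s, f s ∂Q := by
  apply le_antisymm
  · exact iInf_le_of_le f (iInf_le_of_le hf (iInf_le _ fun _ => le_rfl))
  · exact le_iInf fun g => le_iInf fun _ => le_iInf fun h => lintegral_mono h

/-- A finite set `B` of pairs `(l, u)` is an `ε`-bracketing of the family `𝔛` in `L₂(P)`: all
`l, u` are random variables in `L₂(P)` with `‖u - l‖₂ ≤ ε`, and every `X ∈ 𝔛` satisfies
`l ≤ X ≤ u` for one of the pairs. -/
def IsBracketing {Ω : Type*} [MeasurableSpace Ω] (P : Measure Ω) (𝔛 : Set (Ω → ℝ)) (ε : ℝ)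
    (B : Finset ((Ω → ℝ) × (Ω → ℝ))) : Prop :=
  (∀ b ∈ B, Measurable b.1 ∧ Measurable b.2 ∧ MemLp b.1 2 P ∧ MemLp b.2 2 P ∧
    eLpNorm (b.2 - b.1) 2 P ≤ ENNReal.ofReal ε) ∧
  ∀ X ∈ 𝔛, ∃ b ∈ B, b.1 ≤ X ∧ X ≤ b.2

/-- The bracketing number `N_[](ε, 𝔛, L₂(P))`, the least number of `ε`-brackets covering `𝔛`
(`⊤` if no finite number suffices). -/
def bracketingNumber {Ω : Type*} [MeasurableSpace Ω] (P : Measure Ω) (𝔛 : Set (Ω → ℝ))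
    (ε : ℝ) : ℕ∞ :=
  ⨅ (B : Finset ((Ω → ℝ) × (Ω → ℝ))) (_ : IsBracketing P 𝔛 ε B), (B.card : ℕ∞)

/-- The law of `n` independent draws `ω₁, …, ωₙ` from `P`; the i.i.d. copies of `X` are
`X⁽ʲ⁾ = X (ωⱼ)`, the same draws being used for all `X`. -/
abbrev sampleLaw {Ω : Type*} [MeasurableSpace Ω] (P : Measure Ω) (n : ℕ) :
    Measure (Fin n → Ω) :=
  Measure.pi fun _ => P

/-- The empirical mean `E_n[X] = (1/n) ∑ⱼ X⁽ʲ⁾`. -/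
def empMean {Ω : Type*} {n : ℕ} (X : Ω → ℝ) (ω : Fin n → Ω) : ℝ :=
  (1 / (n : ℝ)) * ∑ j, X (ω j)

/-- The empirical second moment `V_n(X) = (1/n) ∑ⱼ (X⁽ʲ⁾)²`. -/
def empVar {Ω : Type*} {n : ℕ} (X : Ω → ℝ) (ω : Fin n → Ω) : ℝ :=
  (1 / (n : ℝ)) * ∑ j, X (ω j) ^ 2

/-- The self-normalized mean `W_n(X) = E_n[X] / √V_n(X)`. If `V_n(X) = 0` then all `X⁽ʲ⁾` vanish,
and the quotient `0 / 0` is `0`. -/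
def selfNorm {Ω : Type*} {n : ℕ} (X : Ω → ℝ) (ω : Fin n → Ω) : ℝ :=
  empMean X ω / Real.sqrt (empVar X ω)

end SelfNormalized

end

/-! The finite brackets supply a square integrable envelope `F` and finitely many brackets for the
squares `X ^ 2` (`exists_envelope_of_bracketing`). After truncation to `F ≤ M` these squares are
bounded, so Hoeffding's inequality controls their empirical means uniformly over the family, with
exponentially small failure probability.

The sums are cut at a level `a` proportional to `√n / (x + 1)`. By Cauchy–Schwarz, the observations
with `F > a` contribute at most `√V_n · √N` to the normalized sum, where `N` is their number.
Dividing by `√V_n` leaves `√N`, which no longer depends on `X` and which Chernoff's bound keeps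
below `δ (x + 1)`. This is what self-normalization buys when only second moments exist. Since `V_n ≥
1 - 3δ` uniformly, there remains a deviation of the supremum `Z` of the truncated sums
(`selfNorm_event_subset`).

For `Z` the entropy method applies: tensorization (`expEntropy_pi_le`) bounds the entropy of `exp (l
Z)` by the resampling variance, and Herbst's argument turns this into a sub-Gaussian Laplace
transform. The resampling variance is about `V_n + 1`, hence about 2. The part of its fluctuation
coming from `F ≤ M` is a rare event; the part from `M < F ≤ a` is treated by the Gibbs inequality,
whose entropy term is absorbed on the left (`integral_exp_le_of_resamplingVar_le`). Variance factor
2 yields the rate `x ^ 2 / 8` to leading order. The condition `α > √2` leaves room in this rate and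
between `C` and `α C`, and all errors are absorbed there. Non-measurability is handled by taking for
`Z` an essentially least measurable majorant, which keeps both the mean bound and the variance bound
of the supremum. -/

namespace SelfNormalized

/-! ### Bounded measurable functions -/

/-- Bounded measurable real functions. -/
structure BddMeas {α : Type*} [MeasurableSpace α] (f : α → ℝ) : Prop where
  meas : Measurable f
  bdd : ∃ c, ∀ x, |f x| ≤ c

section Entropy

variable {α β : Type*} [MeasurableSpace α] [MeasurableSpace β]

namespace BddMeas

variable {f g : α → ℝ}

theorem integrable (hf : BddMeas f) (μ : Measure α) [IsFiniteMeasure μ] : Integrable f μ := by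
  obtain ⟨c, hc⟩ := hf.bdd
  exact Integrable.of_bound hf.meas.aestronglyMeasurable c (ae_of_all _ fun x => by simpa using hc x)

theorem const (c : ℝ) : BddMeas fun _ : α => c := ⟨measurable_const, |c|, fun _ => le_rfl⟩

theorem add (hf : BddMeas f) (hg : BddMeas g) : BddMeas fun x => f x + g x := by
  obtain ⟨c, hc⟩ := hf.bdd
  obtain ⟨d, hd⟩ := hg.bdd
  exact ⟨hf.meas.add hg.meas, c + d, fun x => (abs_add_le _ _).trans (add_le_add (hc x) (hd x))⟩

theorem neg (hf : BddMeas f) : BddMeas fun x => -f x := by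
  obtain ⟨c, hc⟩ := hf.bdd
  exact ⟨hf.meas.neg, c, fun x => by simpa using hc x⟩

theorem sub (hf : BddMeas f) (hg : BddMeas g) : BddMeas fun x => f x - g x := by
  simpa [sub_eq_add_neg] using hf.add hg.neg

theorem mul (hf : BddMeas f) (hg : BddMeas g) : BddMeas fun x => f x * g x := by
  obtain ⟨c, hc⟩ := hf.bdd
  obtain ⟨d, hd⟩ := hg.bdd
  refine ⟨hf.meas.mul hg.meas, c * d, fun x => ?_⟩
  rw [abs_mul]
  exact mul_le_mul (hc x) (hd x) (abs_nonneg _) ((abs_nonneg _).trans (hc x))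

theorem exp (hf : BddMeas f) : BddMeas fun x => Real.exp (f x) := by
  obtain ⟨c, hc⟩ := hf.bdd
  refine ⟨hf.meas.exp, Real.exp c, fun x => ?_⟩
  rw [abs_of_pos (Real.exp_pos _)]
  exact Real.exp_le_exp.2 ((le_abs_self _).trans (hc x))

theorem posPart (hf : BddMeas f) : BddMeas fun x => max (f x) 0 := by
  obtain ⟨c, hc⟩ := hf.bdd
  refine ⟨hf.meas.max measurable_const, c, fun x => ?_⟩
  rw [abs_of_nonneg (le_max_right _ _)]
  exact max_le ((le_abs_self _).trans (hc x)) ((abs_nonneg _).trans (hc x))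

theorem sq (hf : BddMeas f) : BddMeas fun x => f x ^ 2 := by
  simpa [_root_.sq] using hf.mul hf

theorem comp (hf : BddMeas f) {φ : β → α} (hφ : Measurable φ) : BddMeas fun y => f (φ y) := by
  obtain ⟨c, hc⟩ := hf.bdd
  exact ⟨hf.meas.comp hφ, c, fun x => hc _⟩

theorem sum {ι : Type*} {s : Finset ι} {f : ι → α → ℝ} (hf : ∀ i, BddMeas (f i)) :
    BddMeas fun x => ∑ i ∈ s, f i x := by
  classical
  induction s using Finset.induction_on with
  | empty => simpa using const 0
  | insert a s ha ih => simpa [Finset.sum_insert ha] using (hf a).add ih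

theorem integral_right {f : α × β → ℝ} (hf : BddMeas f) (ν : Measure β) [IsProbabilityMeasure ν] :
    BddMeas fun x => ∫ y, f (x, y) ∂ν := by
  obtain ⟨c, hc⟩ := hf.bdd
  refine ⟨?_, c, fun x => ?_⟩
  · exact (StronglyMeasurable.integral_prod_right (f := fun x y => f (x, y))
      hf.meas.stronglyMeasurable).measurable
  · have := norm_integral_le_of_norm_le_const (μ := ν) (f := fun y => f (x, y)) (C := c)
      (ae_of_all _ fun y => by simpa using hc (x, y))
    simpa using this

theorem integral_left {f : α × β → ℝ} (hf : BddMeas f) (μ : Measure α) [IsProbabilityMeasure μ] :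
    BddMeas fun y => ∫ x, f (x, y) ∂μ :=
  integral_right (f := fun p : β × α => f (p.2, p.1)) (hf.comp measurable_swap) μ

theorem log {c : ℝ} (hf : BddMeas f) (hc : 0 < c) (h : ∀ x, c ≤ f x) :
    BddMeas fun x => Real.log (f x) := by
  obtain ⟨d, hd⟩ := hf.bdd
  refine ⟨hf.meas.log, max (-Real.log c) (Real.log d), fun x => abs_le.2 ⟨?_, ?_⟩⟩
  · have := Real.log_le_log hc (h x)
    have := le_max_left (-Real.log c) (Real.log d)
    linarith
  · exact (Real.log_le_log (hc.trans_le (h x)) ((le_abs_self _).trans (hd x))).trans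
      (le_max_right _ _)

theorem exists_exp_lower (hf : BddMeas f) : ∃ c > 0, ∀ x, c ≤ Real.exp (f x) := by
  obtain ⟨d, hd⟩ := hf.bdd
  exact ⟨Real.exp (-d), Real.exp_pos _, fun x => Real.exp_le_exp.2 (abs_le.1 (hd x)).1⟩

end BddMeas

/-! ### Entropy of exponentials and its tensorization -/

/-- The entropy `E[e^g log e^g] - E[e^g] log E[e^g]` of the function `e^g`. -/
noncomputable def expEntropy (μ : Measure α) (g : α → ℝ) : ℝ :=
  ∫ x, Real.exp (g x) * g x ∂μ - (∫ x, Real.exp (g x) ∂μ) * Real.log (∫ x, Real.exp (g x) ∂μ)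

theorem integral_exp_pos' (μ : Measure α) [IsProbabilityMeasure μ] {g : α → ℝ} (hg : BddMeas g) :
    0 < ∫ x, Real.exp (g x) ∂μ :=
  integral_exp_pos (hg.exp.integrable μ)

/-- The Gibbs variational inequality. -/
theorem integral_exp_mul_le (μ : Measure α) [IsProbabilityMeasure μ] {g T : α → ℝ}
    (hg : BddMeas g) (hT : BddMeas T) :
    ∫ x, Real.exp (g x) * T x ∂μ ≤
      expEntropy μ g + (∫ x, Real.exp (g x) ∂μ) * Real.log (∫ x, Real.exp (T x) ∂μ) := by
  set m := ∫ x, Real.exp (g x) ∂μ with hm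
  set s := ∫ x, Real.exp (T x) ∂μ with hs
  have hm0 : 0 < m := integral_exp_pos' μ hg
  have hs0 : 0 < s := integral_exp_pos' μ hT
  -- The inequality `1 + u ≤ exp u` at `u = T - g + log m - log s`, multiplied by `exp g`; the
  -- normalizations by `m` and `s` make it sharp after integration.
  have hpt : ∀ x, Real.exp (g x) * T x ≤ Real.exp (g x) * g x +
      (Real.log s - Real.log m - 1) * Real.exp (g x) + m / s * Real.exp (T x) := by
    intro x
    have h1 := Real.add_one_le_exp (T x - g x + Real.log m - Real.log s)
    have h2 : Real.exp (g x) * Real.exp (T x - g x + Real.log m - Real.log s) =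
        m / s * Real.exp (T x) := by
      rw [Real.exp_sub, Real.exp_add, Real.exp_sub, Real.exp_log hm0, Real.exp_log hs0]
      field_simp
    nlinarith [mul_le_mul_of_nonneg_left h1 (Real.exp_pos (g x)).le]
  have i1 := (hg.exp.mul hg).integrable μ
  have i2 := hg.exp.integrable μ
  have i3 := hT.exp.integrable μ
  calc ∫ x, Real.exp (g x) * T x ∂μ
      ≤ ∫ x, (Real.exp (g x) * g x + (Real.log s - Real.log m - 1) * Real.exp (g x) +
          m / s * Real.exp (T x)) ∂μ :=
        integral_mono ((hg.exp.mul hT).integrable μ)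
          ((i1.add (i2.const_mul _)).add (i3.const_mul _)) hpt
    _ = expEntropy μ g + m * Real.log s := by
        have i12 : Integrable (fun x => Real.exp (g x) * g x +
            (Real.log s - Real.log m - 1) * Real.exp (g x)) μ := i1.add (i2.const_mul _)
        rw [integral_add i12 (i3.const_mul _), integral_add i1 (i2.const_mul _),
          integral_const_mul, integral_const_mul, expEntropy, ← hm, ← hs]
        field_simp
        ring

/-- Jensen replaces `log E[e^g]` by `E[g]`, which produces an independent copy. Exchanging the two
copies keeps only the positive part of the difference, and `e^s - e^t ≤ e^s (s - t)` supplies the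
second factor of the square. -/
theorem expEntropy_le_integral_integral (μ : Measure α) [IsProbabilityMeasure μ] {g : α → ℝ}
    (hg : BddMeas g) :
    expEntropy μ g ≤ ∫ x, Real.exp (g x) * ∫ y, max (g x - g y) 0 ^ 2 ∂μ ∂μ := by
  have hfst : BddMeas fun p : α × α => g p.1 := hg.comp measurable_fst
  have hsnd : BddMeas fun p : α × α => g p.2 := hg.comp measurable_snd
  have hp := (hfst.sub hsnd).posPart
  have hjensen : ∫ x, g x ∂μ ≤ Real.log (∫ x, Real.exp (g x) ∂μ) := by
    rw [Real.le_log_iff_exp_le (integral_exp_pos' μ hg)]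
    exact convexOn_exp.map_integral_le Real.continuous_exp.continuousOn isClosed_univ (by simp)
      (hg.integrable μ) (hg.exp.integrable μ)
  have i1 := (hg.exp.mul hg).integrable μ
  have i2 := hg.exp.integrable μ
  have h1 : expEntropy μ g ≤ ∫ p : α × α, Real.exp (g p.1) * (g p.1 - g p.2) ∂μ.prod μ := by
    rw [integral_prod _ ((hfst.exp.mul (hfst.sub hsnd)).integrable _)]
    have : ∀ x, ∫ y, Real.exp (g x) * (g x - g y) ∂μ =
        Real.exp (g x) * g x - Real.exp (g x) * ∫ y, g y ∂μ := fun x => by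
      rw [integral_const_mul, integral_sub (integrable_const _) (hg.integrable μ)]
      simp [mul_sub]
    simp_rw [this]
    rw [integral_sub i1 (i2.mul_const _), integral_mul_const, expEntropy]
    have := mul_le_mul_of_nonneg_left hjensen (integral_exp_pos' μ hg).le
    linarith
  have hA : BddMeas fun p : α × α => Real.exp (g p.1) * max (g p.1 - g p.2) 0 := hfst.exp.mul hp
  have hB : BddMeas fun p : α × α => Real.exp (g p.2) * max (g p.1 - g p.2) 0 := hsnd.exp.mul hp
  have hB' : BddMeas fun p : α × α => Real.exp (g p.1) * max (g p.2 - g p.1) 0 :=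
    hfst.exp.mul (hsnd.sub hfst).posPart
  have h2 : ∫ p : α × α, Real.exp (g p.1) * (g p.1 - g p.2) ∂μ.prod μ =
      ∫ p : α × α, (Real.exp (g p.1) - Real.exp (g p.2)) * max (g p.1 - g p.2) 0 ∂μ.prod μ := by
    have e1 : ∀ p : α × α, Real.exp (g p.1) * (g p.1 - g p.2) =
        Real.exp (g p.1) * max (g p.1 - g p.2) 0 - Real.exp (g p.1) * max (g p.2 - g p.1) 0 := by
      intro p
      rcases le_total (g p.1) (g p.2) with h | h
      · rw [max_eq_right (sub_nonpos.2 h), max_eq_left (sub_nonneg.2 h)]; ring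
      · rw [max_eq_left (sub_nonneg.2 h), max_eq_right (sub_nonpos.2 h)]; ring
    have e2 : ∫ p : α × α, Real.exp (g p.1) * max (g p.2 - g p.1) 0 ∂μ.prod μ =
        ∫ p : α × α, Real.exp (g p.2) * max (g p.1 - g p.2) 0 ∂μ.prod μ := by
      rw [← integral_prod_swap]
      rfl
    simp_rw [e1, sub_mul]
    rw [integral_sub (hA.integrable _) (hB'.integrable _),
      integral_sub (hA.integrable _) (hB.integrable _), e2]
  have h3 : ∀ p : α × α, (Real.exp (g p.1) - Real.exp (g p.2)) * max (g p.1 - g p.2) 0 ≤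
      Real.exp (g p.1) * max (g p.1 - g p.2) 0 ^ 2 := by
    intro p
    have hle : Real.exp (g p.1) - Real.exp (g p.2) ≤
        Real.exp (g p.1) * max (g p.1 - g p.2) 0 := by
      have h := Real.add_one_le_exp (g p.2 - g p.1)
      have h' : Real.exp (g p.2) = Real.exp (g p.1) * Real.exp (g p.2 - g p.1) := by
        rw [← Real.exp_add]; ring_nf
      have := mul_le_mul_of_nonneg_left h (Real.exp_pos (g p.1)).le
      have := mul_le_mul_of_nonneg_left (le_max_left (g p.1 - g p.2) 0) (Real.exp_pos (g p.1)).le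
      nlinarith
    have := mul_le_mul_of_nonneg_right hle (le_max_right (g p.1 - g p.2) 0)
    nlinarith
  have hC := hfst.exp.mul hp.sq
  refine h1.trans (h2.le.trans ((integral_mono (((hfst.exp.sub hsnd.exp).mul hp).integrable _)
    (hC.integrable _) h3).trans_eq ?_))
  rw [integral_prod _ (hC.integrable _)]
  simp_rw [integral_const_mul]

/-- Subadditivity of the entropy on a product of two probability spaces. -/
theorem expEntropy_prod_le (μ : Measure α) (ν : Measure β) [IsProbabilityMeasure μ]
    [IsProbabilityMeasure ν] {g : α × β → ℝ} (hg : BddMeas g) :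
    expEntropy (μ.prod ν) g ≤ ∫ w, expEntropy μ (fun x => g (x, w)) ∂ν +
      ∫ x, expEntropy ν (fun w => g (x, w)) ∂μ := by
  obtain ⟨c, hc, hcg⟩ := hg.exists_exp_lower
  have hgx : ∀ w, BddMeas fun x => g (x, w) := fun w => hg.comp measurable_prodMk_right
  have hgw : ∀ x, BddMeas fun w => g (x, w) := fun x => hg.comp measurable_prodMk_left
  set h : α → ℝ := fun x => ∫ w, Real.exp (g (x, w)) ∂ν with hh
  set k : β → ℝ := fun w => ∫ x, Real.exp (g (x, w)) ∂μ with hk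
  have hhB : BddMeas h := hg.exp.integral_right ν
  have hkB : BddMeas k := hg.exp.integral_left μ
  have hch : ∀ x, c ≤ h x := fun x => by
    have := integral_mono (integrable_const c) ((hgw x).exp.integrable ν) (fun w => hcg (x, w))
    simpa using this
  have hck : ∀ w, c ≤ k w := fun w => by
    have := integral_mono (integrable_const c) ((hgx w).exp.integrable μ) (fun x => hcg (x, w))
    simpa using this
  set m : ℝ := ∫ p, Real.exp (g p) ∂μ.prod ν with hm
  have hm0 : 0 < m := integral_exp_pos' _ hg
  have hmh : m = ∫ x, h x ∂μ := integral_prod _ (hg.exp.integrable _)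
  have hlh := hhB.log hc hch
  have hlk := hkB.log hc hck
  -- By the chain rule the joint entropy is the mean entropy in `w` plus the entropy of the marginal
  -- `h`. This `T` is the log-density of `h`, so `E[e^T] = 1` and the Gibbs inequality for each
  -- fixed `w` bounds the entropy of `h` by the mean entropy in `x`.
  set T : α → ℝ := fun x => Real.log (h x) - Real.log m with hT
  have hTB : BddMeas T := hlh.sub (BddMeas.const _)
  have heT : ∫ x, Real.exp (T x) ∂μ = 1 := by
    have : ∀ x, Real.exp (T x) = h x / m := fun x => by
      rw [hT, Real.exp_sub, Real.exp_log (hc.trans_le (hch x)), Real.exp_log hm0]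
    simp_rw [this]
    rw [integral_div, ← hmh, div_self hm0.ne']
  have hTp : BddMeas fun p : α × β => Real.exp (g p) * T p.1 :=
    hg.exp.mul (hTB.comp measurable_fst)
  have hgg : BddMeas fun p : α × β => Real.exp (g p) * g p := hg.exp.mul hg
  have hent1 : BddMeas fun w => expEntropy μ fun x => g (x, w) :=
    (hgg.integral_left μ).sub (hkB.mul hlk)
  have hgibbs : ∫ w, ∫ x, Real.exp (g (x, w)) * T x ∂μ ∂ν ≤
      ∫ w, expEntropy μ (fun x => g (x, w)) ∂ν := by
    refine integral_mono ((hTp.integral_left μ).integrable ν) (hent1.integrable ν) fun w => ?_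
    have := integral_exp_mul_le μ (hgx w) hTB
    simpa [heT] using this
  have hswap : ∫ w, ∫ x, Real.exp (g (x, w)) * T x ∂μ ∂ν =
      ∫ x, h x * Real.log (h x) ∂μ - m * Real.log m := by
    rw [← integral_prod_symm _ (hTp.integrable (μ.prod ν)),
      integral_prod _ (hTp.integrable (μ.prod ν))]
    simp only [integral_mul_const]
    have : ∀ x, (∫ w, Real.exp (g (x, w)) ∂ν) * T x =
        h x * Real.log (h x) - h x * Real.log m := fun x => by rw [hT, mul_sub]
    simp_rw [this]
    rw [integral_sub ((hhB.mul hlh).integrable μ) ((hhB.integrable μ).mul_const _),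
      integral_mul_const, ← hmh]
  have hent2 : ∫ x, expEntropy ν (fun w => g (x, w)) ∂μ =
      ∫ p, Real.exp (g p) * g p ∂μ.prod ν - ∫ x, h x * Real.log (h x) ∂μ := by
    rw [integral_prod _ (hgg.integrable _),
      ← integral_sub ((hgg.integral_right ν).integrable μ) ((hhB.mul hlh).integrable μ)]
    rfl
  rw [hent2]
  have : expEntropy (μ.prod ν) g = ∫ p, Real.exp (g p) * g p ∂μ.prod ν - m * Real.log m := rfl
  rw [this]
  linarith [hswap ▸ hgibbs]

/-- The contribution of resampling to the variance, given the sample `ω`. -/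
noncomputable def resamplingVar (μ : Measure α) {n : ℕ} (g : (Fin n → α) → ℝ) (ω : Fin n → α) :
    ℝ :=
  ∑ j, ∫ y, max (g ω - g (Function.update ω j y)) 0 ^ 2 ∂μ

theorem BddMeas.update_diff {n : ℕ} {g : (Fin n → α) → ℝ} (hg : BddMeas g) (j : Fin n) :
    BddMeas fun p : (Fin n → α) × α => max (g p.1 - g (Function.update p.1 j p.2)) 0 ^ 2 :=
  ((hg.comp measurable_fst).sub (hg.comp measurable_update')).posPart.sq

theorem BddMeas.resamplingVar (μ : Measure α) [IsProbabilityMeasure μ] {n : ℕ}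
    {g : (Fin n → α) → ℝ} (hg : BddMeas g) : BddMeas (resamplingVar μ g) :=
  BddMeas.sum fun j => (hg.update_diff j).integral_right μ

theorem integral_pi_succ (μ : Measure α) [IsProbabilityMeasure μ] {n : ℕ}
    (f : (Fin (n + 1) → α) → ℝ) :
    ∫ ω, f ω ∂(Measure.pi fun _ : Fin (n + 1) => μ) =
      ∫ p : α × (Fin n → α), f (Fin.cons p.1 p.2) ∂μ.prod (Measure.pi fun _ : Fin n => μ) := by
  rw [← (measurePreserving_piFinSuccAbove (fun _ : Fin (n + 1) => μ) 0).integral_comp']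
  congr 1
  ext ω
  congr 1
  exact (Fin.cons_self_tail ω).symm

theorem measurable_finCons {n : ℕ} :
    Measurable fun p : α × (Fin n → α) => (Fin.cons p.1 p.2 : Fin (n + 1) → α) := by
  refine measurable_pi_iff.2 fun i => ?_
  refine Fin.cases ?_ (fun i => ?_) i
  · simpa using measurable_fst
  · simp only [Fin.cons_succ]
    exact (measurable_pi_apply i).comp measurable_snd

/-- Modified logarithmic Sobolev inequality on product spaces. -/
theorem expEntropy_pi_le (μ : Measure α) [IsProbabilityMeasure μ] {n : ℕ}
    {g : (Fin n → α) → ℝ} (hg : BddMeas g) :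
    expEntropy (Measure.pi fun _ : Fin n => μ) g ≤
      ∫ ω, Real.exp (g ω) * resamplingVar μ g ω ∂(Measure.pi fun _ : Fin n => μ) := by
  induction n with
  | zero =>
    have : ∀ ω, g ω = g default := fun ω => congrArg g (Subsingleton.elim _ _)
    simp only [expEntropy, resamplingVar]
    simp_rw [this]
    simp
  | succ n ih =>
    set ν := Measure.pi fun _ : Fin n => μ
    have hg' : BddMeas fun p : α × (Fin n → α) => g (Fin.cons p.1 p.2) :=
      hg.comp measurable_finCons
    have hgx : ∀ w : Fin n → α, BddMeas fun x => g (Fin.cons x w) :=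
      fun w => hg'.comp measurable_prodMk_right
    have hgw : ∀ x, BddMeas fun w : Fin n → α => g (Fin.cons x w) :=
      fun x => hg'.comp measurable_prodMk_left
    obtain ⟨c, hc, hcg⟩ := hg'.exists_exp_lower
    have heq : expEntropy (Measure.pi fun _ : Fin (n + 1) => μ) g =
        expEntropy (μ.prod ν) fun p => g (Fin.cons p.1 p.2) := by
      simp only [expEntropy]
      rw [integral_pi_succ, integral_pi_succ]
    have hV : BddMeas fun p : α × (Fin n → α) =>
        Real.exp (g (Fin.cons p.1 p.2)) * resamplingVar μ g (Fin.cons p.1 p.2) :=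
      hg'.exp.mul ((hg.resamplingVar μ).comp measurable_finCons)
    have hsplit : ∀ (x : α) (w : Fin n → α), resamplingVar μ g (Fin.cons x w) =
        ∫ y, max (g (Fin.cons x w) - g (Fin.cons y w)) 0 ^ 2 ∂μ +
          resamplingVar μ (fun w => g (Fin.cons x w)) w := by
      intro x w
      simp only [resamplingVar]
      rw [Fin.sum_univ_succ]
      simp only [Fin.update_cons_zero, Fin.cons_update]
    have h0 : BddMeas fun p : α × (Fin n → α) =>
        ∫ y, max (g (Fin.cons p.1 p.2) - g (Fin.cons y p.2)) 0 ^ 2 ∂μ := by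
      have := ((hg.update_diff 0).integral_right μ).comp (measurable_finCons (α := α) (n := n))
      simpa only [Fin.update_cons_zero] using this
    have h0' := hg'.exp.mul h0
    have h1 : BddMeas fun p : α × (Fin n → α) =>
        Real.exp (g (Fin.cons p.1 p.2)) * resamplingVar μ (fun w => g (Fin.cons p.1 w)) p.2 := by
      have := hV.sub h0'
      simp_rw [hsplit, mul_add, add_sub_cancel_left] at this
      exact this
    rw [heq, integral_pi_succ]
    refine (expEntropy_prod_le μ ν hg').trans ?_
    have hR : ∫ p : α × (Fin n → α), Real.exp (g (Fin.cons p.1 p.2)) *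
          resamplingVar μ g (Fin.cons p.1 p.2) ∂μ.prod ν =
        ∫ w, ∫ x, Real.exp (g (Fin.cons x w)) *
            ∫ y, max (g (Fin.cons x w) - g (Fin.cons y w)) 0 ^ 2 ∂μ ∂μ ∂ν +
          ∫ x, ∫ w, Real.exp (g (Fin.cons x w)) *
            resamplingVar μ (fun w => g (Fin.cons x w)) w ∂ν ∂μ := by
      simp_rw [hsplit, mul_add]
      rw [integral_add (h0'.integrable _) (h1.integrable _),
        integral_prod_symm _ (h0'.integrable _), integral_prod _ (h1.integrable _)]
    rw [hR]
    have hent2 : BddMeas fun x => expEntropy ν fun w => g (Fin.cons x w) := by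
      have hE := hg'.exp.integral_right ν
      refine ((hg'.exp.mul hg').integral_right ν).sub (hE.mul (hE.log hc fun x => ?_))
      have := integral_mono (integrable_const c) ((hgw x).exp.integrable ν) (fun w => hcg (x, w))
      simpa using this
    have hent1 : BddMeas fun w : Fin n → α => expEntropy μ fun x => g (Fin.cons x w) := by
      have hE := hg'.exp.integral_left μ
      refine ((hg'.exp.mul hg').integral_left μ).sub (hE.mul (hE.log hc fun w => ?_))
      have := integral_mono (integrable_const c) ((hgx w).exp.integrable μ) (fun x => hcg (x, w))
      simpa using this
    -- Resampling the new coordinate is the one-variable inequality; resampling the others, with the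
    -- new one frozen, is the induction hypothesis.
    refine add_le_add ?_ ?_
    · exact integral_mono (hent1.integrable ν) ((h0'.integral_left μ).integrable ν)
        fun w => expEntropy_le_integral_integral μ (hgx w)
    · exact integral_mono (hent2.integrable μ) ((h1.integral_right ν).integrable μ)
        fun x => ih (hgw x)

end Entropy

/-! ### From entropy bounds to exponential moments and tails. -/

section Herbst

variable {α : Type*} [MeasurableSpace α]

theorem hasDerivAt_cgf_of_bddMeas (μ : Measure α) [IsProbabilityMeasure μ] {Z : α → ℝ}
    (hZ : BddMeas Z) (l : ℝ) :
    HasDerivAt (ProbabilityTheory.cgf Z μ)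
      ((∫ x, Z x * Real.exp (l * Z x) ∂μ) / ∫ x, Real.exp (l * Z x) ∂μ) l := by
  have huniv : ProbabilityTheory.integrableExpSet Z μ = Set.univ :=
    Set.eq_univ_of_forall fun t => ((BddMeas.const t).mul hZ).exp.integrable μ
  have hl : l ∈ interior (ProbabilityTheory.integrableExpSet Z μ) := by simp [huniv]
  exact (ProbabilityTheory.hasDerivAt_mgf hl).log
    (integral_exp_pos' μ ((BddMeas.const l).mul hZ)).ne'

/-- Herbst's argument. -/
theorem integral_exp_le_of_expEntropy_le (μ : Measure α) [IsProbabilityMeasure μ] {Z : α → ℝ}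
    (hZ : BddMeas Z) {L v : ℝ} (hL : 0 < L)
    (h : ∀ l, 0 < l → l ≤ L →
      expEntropy μ (fun x => l * Z x) ≤ v * l ^ 2 * ∫ x, Real.exp (l * Z x) ∂μ) :
    ∫ x, Real.exp (L * Z x) ∂μ ≤ Real.exp (L * ∫ x, Z x ∂μ + v * L ^ 2) := by
  set K := ProbabilityTheory.cgf Z μ with hK
  have hKl : ∀ l, K l = Real.log (∫ x, Real.exp (l * Z x) ∂μ) := fun l => rfl
  have hpos : ∀ l, 0 < ∫ x, Real.exp (l * Z x) ∂μ :=
    fun l => integral_exp_pos' μ ((BddMeas.const l).mul hZ)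
  set D : ℝ → ℝ := fun l =>
    (∫ x, Z x * Real.exp (l * Z x) ∂μ) / ∫ x, Real.exp (l * Z x) ∂μ with hD
  have hder : ∀ l, HasDerivAt K (D l) l := hasDerivAt_cgf_of_bddMeas μ hZ
  have hφ : ∀ l, 0 < l →
      HasDerivAt (fun l => K l / l - v * l) ((D l * l - K l * 1) / l ^ 2 - v * 1) l :=
    fun l hl => ((hder l).div (hasDerivAt_id l) hl.ne').sub ((hasDerivAt_id l).const_mul v)
  -- The entropy of `e^{lZ}` divided by its mean is `l K' - K`, that is `l ^ 2 (K / l)'`, so the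
  -- hypothesis says `(K / l)' ≤ v`. The value at `0+` is `K'(0) = E[Z]`.
  have hanti : AntitoneOn (fun l => K l / l - v * l) (Set.Ioc 0 L) := by
    refine antitoneOn_of_deriv_nonpos (convex_Ioc 0 L)
      (fun l hl => (hφ l hl.1).continuousAt.continuousWithinAt) ?_ ?_
    · intro l hl
      rw [interior_Ioc] at hl
      exact (hφ l hl.1).differentiableAt.differentiableWithinAt
    · intro l hl
      rw [interior_Ioc] at hl
      rw [(hφ l hl.1).deriv]
      have hent := h l hl.1 hl.2.le
      have hent' : expEntropy μ (fun x => l * Z x) =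
          (∫ x, Real.exp (l * Z x) ∂μ) * (D l * l - K l) := by
        have e : ∫ x, Real.exp (l * Z x) * (l * Z x) ∂μ =
            l * ∫ x, Z x * Real.exp (l * Z x) ∂μ := by
          rw [← integral_const_mul]
          congr 1; ext x; ring
        rw [expEntropy, e, hKl, hD]
        field_simp [(hpos l).ne']
      rw [hent', mul_comm (v * l ^ 2)] at hent
      have h1 := le_of_mul_le_mul_left hent (hpos l)
      have h2 : (D l * l - K l * 1) / l ^ 2 ≤ v := by
        rw [div_le_iff₀ (pow_pos hl.1 2)]; linarith
      linarith
  have hD0 : D 0 = ∫ x, Z x ∂μ := by simp [hD]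
  have hlim : Tendsto (fun l => K l / l - v * l) (nhdsWithin 0 (Set.Ioi 0))
      (nhds (∫ x, Z x ∂μ - v * 0)) := by
    have h1 := (hasDerivAt_iff_tendsto_slope_zero.1 (hder 0)).mono_left
      (nhdsWithin_mono 0 fun x (hx : 0 < x) => hx.ne')
    have hK0 : K 0 = 0 := by simp [hK]
    simp only [zero_add, hK0, sub_zero, smul_eq_mul, hD0] at h1
    refine Tendsto.sub ?_ ((continuous_const.mul continuous_id).continuousWithinAt.tendsto)
    exact h1.congr fun l => by rw [div_eq_inv_mul]
  have hle : K L / L - v * L ≤ ∫ x, Z x ∂μ - v * 0 := by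
    refine ge_of_tendsto hlim ?_
    filter_upwards [Ioc_mem_nhdsGT hL] with l hl
    exact hanti hl ⟨hL, le_rfl⟩ hl.2
  rw [← Real.log_le_iff_le_exp (hpos L), ← hKl]
  have : K L / L ≤ ∫ x, Z x ∂μ + v * L := by linarith
  rw [div_le_iff₀ hL] at this
  nlinarith

/-- Chernoff's bound in exponential form. -/
theorem measureReal_le_exp (μ : Measure α) [IsProbabilityMeasure μ] {Z : α → ℝ}
    (hZ : BddMeas Z) {s : Set α} {t c : ℝ} (hs : ∀ x ∈ s, t ≤ Z x)
    (h : ∫ x, Real.exp (Z x) ∂μ ≤ Real.exp c) : μ.real s ≤ Real.exp (c - t) := by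
  have h1 : μ.real s ≤ μ.real {x | Real.exp t ≤ Real.exp (Z x)} :=
    measureReal_mono fun x hx => Real.exp_le_exp.2 (hs x hx)
  have h2 := mul_meas_ge_le_integral_of_nonneg (μ := μ) (f := fun x => Real.exp (Z x))
    (ae_of_all _ fun x => (Real.exp_pos _).le) (hZ.exp.integrable μ) (Real.exp t)
  rw [Real.exp_sub, le_div_iff₀ (Real.exp_pos t), mul_comm]
  exact (mul_le_mul_of_nonneg_left h1 (Real.exp_pos t).le).trans (h2.trans h)

end Herbst

/-! ### Measurable majorants of non-measurable suprema. -/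

section Cover

/-- Every bounded function has a least measurable majorant, up to null sets. -/
theorem exists_measurable_cover {α : Type*} [MeasurableSpace α] (ν : Measure α)
    [IsProbabilityMeasure ν] {Z : α → ℝ} {B : ℝ} (hZ : ∀ x, |Z x| ≤ B) :
    ∃ Z' : α → ℝ, Measurable Z' ∧ (∀ x, |Z' x| ≤ B) ∧ (∀ x, Z x ≤ Z' x) ∧
      ∀ G : α → ℝ, Measurable G → (∀ x, Z x ≤ G x) → Z' ≤ᵐ[ν] G := by
  -- A largest measurable minorant of the nonnegative function `B - Z`, to be reflected back.
  obtain ⟨g, hgm, hgle, hgeq⟩ :=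
    exists_measurable_le_lintegral_eq ν fun x => ENNReal.ofReal (B - Z x)
  have hZle : ∀ x, 0 ≤ B - Z x := fun x => sub_nonneg.2 ((le_abs_self _).trans (hZ x))
  have hgt : ∀ x, g x ≠ ⊤ := fun x => ((hgle x).trans_lt ENNReal.ofReal_lt_top).ne
  have hgr : ∀ x, (g x).toReal ≤ B - Z x := fun x =>
    ENNReal.toReal_le_of_le_ofReal (hZle x) (hgle x)
  refine ⟨fun x => B - (g x).toReal, measurable_const.sub hgm.ennreal_toReal, fun x => ?_,
    fun x => by linarith [hgr x], fun G hG hZG => ?_⟩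
  · have h0 : 0 ≤ (g x).toReal := ENNReal.toReal_nonneg
    have := abs_le.1 (hZ x)
    exact abs_le.2 ⟨by linarith [hgr x], by linarith⟩
  -- A competitor `G` turns into another measurable minorant `m ≥ g`; maximality of the integral of
  -- `g` forces `m = g` almost everywhere.
  · set m : α → ℝ≥0∞ := fun x => max (g x) (ENNReal.ofReal (B - G x)) with hm
    have hmle : ∀ x, m x ≤ ENNReal.ofReal (B - Z x) := fun x =>
      max_le (hgle x) (ENNReal.ofReal_le_ofReal (by linarith [hZG x]))
    have hfin : ∫⁻ x, g x ∂ν ≠ ⊤ := by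
      refine ne_top_of_le_ne_top (b := ∫⁻ _, ENNReal.ofReal (2 * B) ∂ν)
        (by simp [ENNReal.mul_eq_top])
        (lintegral_mono fun x => (hgle x).trans (ENNReal.ofReal_le_ofReal ?_))
      linarith [(abs_le.1 (hZ x)).1]
    have hae : g =ᵐ[ν] m := ae_eq_of_ae_le_of_lintegral_le (ae_of_all _ fun x => le_max_left _ _)
      hfin (hgm.max (measurable_const.sub hG).ennreal_ofReal).aemeasurable
      ((lintegral_mono hmle).trans hgeq.le)
    filter_upwards [hae] with x hx
    have h1 : ENNReal.ofReal (B - G x) ≤ g x := by rw [hx]; exact le_max_right _ _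
    have := (ENNReal.ofReal_le_iff_le_toReal (hgt x)).1 h1
    linarith

/-- The supremum of an empirical process over a uniformly bounded class has a measurable majorant
that is essentially minimal and inherits the self-bounding property of the supremum. -/
theorem exists_cover_sup_empirical {Ω : Type*} [MeasurableSpace Ω] (μ : Measure Ω)
    [IsProbabilityMeasure μ] (n : ℕ) {H : Set (Ω → ℝ)} (hne : H.Nonempty) {b : ℝ}
    (hb : ∀ h ∈ H, ∀ y, |h y| ≤ b) (hmeas : ∀ h ∈ H, Measurable h) :
    ∃ Z : (Fin n → Ω) → ℝ, Measurable Z ∧ (∀ ω, |Z ω| ≤ n * b) ∧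
      (∀ h ∈ H, ∀ ω, ∑ j, h (ω j) ≤ Z ω) ∧
      (∀ G : (Fin n → Ω) → ℝ, Measurable G → (∀ h ∈ H, ∀ ω, ∑ j, h (ω j) ≤ G ω) →
        Z ≤ᵐ[Measure.pi fun _ : Fin n => μ] G) ∧
      ∀ W : (Fin n → Ω) → ℝ, Measurable W →
        (∀ h ∈ H, ∀ ω, ∑ j, ∫ y, (h (ω j) - h y) ^ 2 ∂μ ≤ W ω) →
        ∀ᵐ ω ∂(Measure.pi fun _ : Fin n => μ), resamplingVar μ Z ω ≤ W ω := by
  have hsum : ∀ h ∈ H, ∀ ω : Fin n → Ω, |∑ j, h (ω j)| ≤ n * b := fun h hh ω => by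
    refine (Finset.abs_sum_le_sum_abs _ _).trans ((Finset.sum_le_sum fun j _ => hb h hh _).trans ?_)
    simp
  have hbdd : ∀ ω : Fin n → Ω, BddAbove (Set.range fun h : H => ∑ j, h.1 (ω j)) := fun ω =>
    ⟨n * b, by rintro _ ⟨h, rfl⟩; exact (abs_le.1 (hsum h.1 h.2 ω)).2⟩
  have hne' : Nonempty H := hne.to_subtype
  obtain ⟨Z, hZm, hZb, hZle, hZmin⟩ := exists_measurable_cover (Measure.pi fun _ : Fin n => μ)
    (Z := fun ω => ⨆ h : H, ∑ j, h.1 (ω j)) (B := n * b) fun ω => by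
      obtain ⟨h, hh⟩ := hne
      exact abs_le.2 ⟨(abs_le.1 (hsum h hh ω)).1.trans (le_ciSup (hbdd ω) ⟨h, hh⟩),
        ciSup_le fun h => (abs_le.1 (hsum h.1 h.2 ω)).2⟩
  have hZH : ∀ h ∈ H, ∀ ω, ∑ j, h (ω j) ≤ Z ω := fun h hh ω =>
    (le_ciSup (hbdd ω) ⟨h, hh⟩).trans (hZle ω)
  have hmin : ∀ G : (Fin n → Ω) → ℝ, Measurable G → (∀ h ∈ H, ∀ ω, ∑ j, h (ω j) ≤ G ω) →
      Z ≤ᵐ[Measure.pi fun _ : Fin n => μ] G := fun G hG hHG =>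
    hZmin G hG fun ω => ciSup_le fun h => hHG h.1 h.2 ω
  refine ⟨Z, hZm, hZb, hZH, hmin, fun W hW hWH => ?_⟩
  have hZB : BddMeas Z := ⟨hZm, _, hZb⟩
  -- For an attained supremum one would compare with a maximizing `h`. The cover `Z` need not be
  -- nearly attained pointwise, but on the exceptional set `S` no sum can exceed `Z - δ`: a `δ`-near
  -- maximizer would give the variance bound with error `(|d| + δ) ^ 2 - d ^ 2 ≤ 4bδ + δ ^ 2`, as
  -- `|d| ≤ 2b`. Hence `Z - δ 1_S` is still a majorant, and minimality of `Z` makes `S` null.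
  have key : ∀ δ : ℝ, 0 < δ → ∀ᵐ ω ∂(Measure.pi fun _ : Fin n => μ),
      resamplingVar μ Z ω ≤ W ω + n * (4 * b * δ + δ ^ 2) := by
    intro δ hδ
    set S : Set (Fin n → Ω) := {ω | W ω + n * (4 * b * δ + δ ^ 2) < resamplingVar μ Z ω} with hS
    have hSm : MeasurableSet S :=
      measurableSet_lt (hW.add measurable_const) (hZB.resamplingVar μ).meas
    have hG := hmin (fun ω => Z ω - S.indicator (fun _ => δ) ω)
      (hZm.sub (measurable_const.indicator hSm)) fun h hh ω => by
        by_cases hω : ω ∈ S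
        · rw [Set.indicator_of_mem hω]
          by_contra! hcon
          refine absurd (show W ω + n * (4 * b * δ + δ ^ 2) < resamplingVar μ Z ω from hω)
            (not_lt.2 ?_)
          have hB : BddMeas h := ⟨hmeas h hh, b, hb h hh⟩
          have hterm : ∀ j, ∫ y, max (Z ω - Z (Function.update ω j y)) 0 ^ 2 ∂μ ≤
              ∫ y, (h (ω j) - h y) ^ 2 ∂μ + (4 * b * δ + δ ^ 2) := by
            intro j
            have hI := (((BddMeas.const (h (ω j))).sub hB).sq).integrable μ
            have hc : ∫ y, ((h (ω j) - h y) ^ 2 + (4 * b * δ + δ ^ 2)) ∂μ =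
                ∫ y, (h (ω j) - h y) ^ 2 ∂μ + (4 * b * δ + δ ^ 2) := by
              rw [integral_add hI (integrable_const _)]; simp
            rw [← hc]
            refine integral_mono
              (((hZB.update_diff j).comp measurable_prodMk_left).integrable μ)
              (hI.add (integrable_const _)) fun y => ?_
            have h1 := hZH h hh (Function.update ω j y)
            have h2 : ∑ i, h (Function.update ω j y i) = ∑ i, h (ω i) - h (ω j) + h y := by
              rw [← Finset.add_sum_erase _ _ (Finset.mem_univ j),
                ← Finset.add_sum_erase _ (fun i => h (ω i)) (Finset.mem_univ j)]
              have : ∀ i ∈ Finset.univ.erase j, h (Function.update ω j y i) = h (ω i) :=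
                fun i hi => by rw [Function.update_of_ne (Finset.ne_of_mem_erase hi)]
              rw [Finset.sum_congr rfl this, Function.update_self]
              ring
            have h3 : max (Z ω - Z (Function.update ω j y)) 0 ≤ |h (ω j) - h y| + δ := by
              refine max_le ?_ (by positivity)
              have := le_abs_self (h (ω j) - h y)
              linarith
            have h4 : |h (ω j) - h y| ≤ 2 * b := by
              have := hb h hh (ω j)
              have := hb h hh y
              exact (abs_sub _ _).trans (by linarith)
            have h5 := pow_le_pow_left₀ (le_max_right _ _) h3 2
            have h6 := sq_abs (h (ω j) - h y)
            show max (Z ω - Z (Function.update ω j y)) 0 ^ 2 ≤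
              (h (ω j) - h y) ^ 2 + (4 * b * δ + δ ^ 2)
            nlinarith
          calc resamplingVar μ Z ω
              ≤ ∑ j, (∫ y, (h (ω j) - h y) ^ 2 ∂μ + (4 * b * δ + δ ^ 2)) :=
                Finset.sum_le_sum fun j _ => hterm j
            _ = ∑ j, ∫ y, (h (ω j) - h y) ^ 2 ∂μ + n * (4 * b * δ + δ ^ 2) := by
                rw [Finset.sum_add_distrib]; simp [mul_add]
            _ ≤ _ := by linarith [hWH h hh ω]
        · rw [Set.indicator_of_notMem hω]
          simpa using hZH h hh ω
    filter_upwards [hG] with ω hω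
    by_contra! hcon
    have : ω ∈ S := hcon
    simp only [Set.indicator_of_mem this] at hω
    linarith
  have hall : ∀ᵐ ω ∂(Measure.pi fun _ : Fin n => μ), ∀ k : ℕ, resamplingVar μ Z ω ≤
      W ω + n * (4 * b * (1 / ((k : ℝ) + 1)) + (1 / ((k : ℝ) + 1)) ^ 2) :=
    ae_all_iff.2 fun k => key _ (by positivity)
  filter_upwards [hall] with ω hω
  have hlim : Tendsto (fun k : ℕ => W ω +
      n * (4 * b * (1 / ((k : ℝ) + 1)) + (1 / ((k : ℝ) + 1)) ^ 2)) atTop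
      (nhds (W ω + n * (4 * b * 0 + 0 ^ 2))) := by
    have := tendsto_one_div_add_atTop_nhds_zero_nat (𝕜 := ℝ)
    exact (((this.const_mul _).add (this.pow 2)).const_mul _).const_add _
  simpa using ge_of_tendsto' hlim hω

end Cover

/-! ### Exponential inequalities for independent samples. -/

section Sample

variable {Ω : Type*} [MeasurableSpace Ω] (μ : Measure Ω) [IsProbabilityMeasure μ]

theorem integral_exp_sum_le {n : ℕ} {T : Ω → ℝ} :
    ∫ ω, Real.exp (∑ j, T (ω j)) ∂(Measure.pi fun _ : Fin n => μ) ≤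
      Real.exp (n * (∫ y, Real.exp (T y) ∂μ - 1)) := by
  simp_rw [Real.exp_sum]
  rw [integral_fintype_prod_eq_prod (fun (_ : Fin n) y => Real.exp (T y))]
  rw [Finset.prod_const, Finset.card_univ, Fintype.card_fin, Real.exp_nat_mul]
  refine pow_le_pow_left₀ (integral_nonneg fun y => (Real.exp_pos _).le) ?_ n
  have := Real.add_one_le_exp (∫ y, Real.exp (T y) ∂μ - 1)
  linarith

/-- Each summand satisfies `e^u ≤ 1 + 2u` on `[0, 1]`, so the cumulant is governed by the mean
alone. This suits a term of small mean whose upper bound may grow with the sample. -/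
theorem log_integral_exp_sum_le {n : ℕ} {r : Ω → ℝ} (hr : BddMeas r) {c : ℝ}
    (h0 : ∀ y, 0 ≤ c * r y) (h1 : ∀ y, c * r y ≤ 1) :
    Real.log (∫ ω, Real.exp (c * ∑ j, r (ω j)) ∂(Measure.pi fun _ : Fin n => μ)) ≤
      2 * c * (n * ∫ y, r y ∂μ) := by
  have hB : BddMeas fun ω : Fin n → Ω => c * ∑ j, r (ω j) :=
    (BddMeas.const c).mul (BddMeas.sum fun j => hr.comp (measurable_pi_apply j))
  rw [Real.log_le_iff_le_exp (integral_exp_pos' _ hB)]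
  simp_rw [Finset.mul_sum]
  refine (integral_exp_sum_le μ (T := fun y => c * r y)).trans (Real.exp_le_exp.2 ?_)
  have hle : ∀ y, Real.exp (c * r y) ≤ 1 + 2 * c * r y := fun y => by
    have h := Real.abs_exp_sub_one_le (x := c * r y) (by rw [abs_of_nonneg (h0 y)]; exact h1 y)
    rw [abs_of_nonneg (h0 y)] at h
    linarith [(abs_le.1 h).2]
  have hint := (hr.integrable μ).const_mul (2 * c)
  have := integral_mono (((BddMeas.const c).mul hr).exp.integrable μ)
    ((integrable_const 1).add hint) hle
  have e : ∫ y, (1 + 2 * c * r y) ∂μ = 1 + 2 * c * ∫ y, r y ∂μ := by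
    rw [integral_add (integrable_const 1) hint, integral_const_mul]; simp
  have h2 : ∫ y, Real.exp (c * r y) ∂μ - 1 ≤ 2 * c * ∫ y, r y ∂μ := by
    have h3 : ∫ y, Real.exp (c * r y) ∂μ ≤ ∫ y, (1 + 2 * c * r y) ∂μ := this
    linarith
  calc _ ≤ n * (2 * c * ∫ y, r y ∂μ) := mul_le_mul_of_nonneg_left h2 (Nat.cast_nonneg n)
    _ = _ := by ring

/-- Hoeffding's inequality for the upper tail of the empirical mean. -/
theorem measureReal_sum_ge_le {n : ℕ} {Y : Ω → ℝ} (hY : Measurable Y) {B m t : ℝ}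
    (h0 : ∀ y, 0 ≤ Y y) (h1 : ∀ y, Y y ≤ B) (hm : ∫ y, Y y ∂μ ≤ m) (ht : 0 ≤ t) :
    (Measure.pi fun _ : Fin n => μ).real {ω | n * (m + t) ≤ ∑ j, Y (ω j)} ≤
      Real.exp (-(2 * t ^ 2 / B ^ 2 * n)) := by
  have hsub := ProbabilityTheory.hasSubgaussianMGF_of_mem_Icc (μ := μ) (X := Y) (a := 0) (b := B)
    hY.aemeasurable (ae_of_all _ fun y => ⟨h0 y, h1 y⟩)
  have hind := ProbabilityTheory.iIndepFun_pi (μ := fun _ : Fin n => μ)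
    (X := fun _ y => Y y - ∫ z, Y z ∂μ) fun _ => (hY.sub_const _).aemeasurable
  have hX : ∀ i ∈ (Finset.univ : Finset (Fin n)), ProbabilityTheory.HasSubgaussianMGF
      (fun ω : Fin n → Ω => Y (ω i) - ∫ z, Y z ∂μ) ((‖B - 0‖₊ / 2) ^ 2)
      (Measure.pi fun _ : Fin n => μ) := fun i _ => by
    have hmp := measurePreserving_eval (fun _ : Fin n => μ) i
    refine ProbabilityTheory.HasSubgaussianMGF.of_map (Y := fun ω : Fin n → Ω => ω i)
      (X := fun y => Y y - ∫ z, Y z ∂μ) hmp.measurable.aemeasurable ?_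
    have : Measure.map (fun ω : Fin n → Ω => ω i) (Measure.pi fun _ : Fin n => μ) = μ := hmp.map_eq
    rw [this]
    exact hsub
  have := ProbabilityTheory.HasSubgaussianMGF.measure_sum_ge_le_of_iIndepFun hind hX
    (ε := n * t) (by positivity)
  refine (measureReal_mono fun ω hω => ?_).trans (this.trans_eq ?_)
  · simp only [Set.mem_ofPred_eq, Finset.sum_sub_distrib] at hω ⊢
    have := mul_le_mul_of_nonneg_left hm (Nat.cast_nonneg (α := ℝ) n)
    simp only [Finset.sum_const, Finset.card_univ, Fintype.card_fin, nsmul_eq_mul]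
    linarith
  · congr 1
    rcases Nat.eq_zero_or_pos n with rfl | hn
    · simp
    have : (0 : ℝ) < n := by exact_mod_cast hn
    by_cases hB : B = 0
    · simp [hB]
    simp
    field_simp
    rw [sq_abs]

/-- Hoeffding's inequality for the lower tail of the empirical mean. -/
theorem measureReal_sum_le_le {n : ℕ} {Y : Ω → ℝ} (hY : Measurable Y) {B m t : ℝ}
    (h0 : ∀ y, 0 ≤ Y y) (h1 : ∀ y, Y y ≤ B) (hm : m ≤ ∫ y, Y y ∂μ) (ht : 0 ≤ t) :
    (Measure.pi fun _ : Fin n => μ).real {ω | ∑ j, Y (ω j) ≤ n * (m - t)} ≤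
      Real.exp (-(2 * t ^ 2 / B ^ 2 * n)) := by
  have hYB : BddMeas Y := ⟨hY, B, fun y => abs_le.2 ⟨by linarith [h0 y, h1 y], h1 y⟩⟩
  have := measureReal_sum_ge_le μ (n := n) (Y := fun y => B - Y y) (B := B) (m := B - m) (t := t)
    (measurable_const.sub hY) (fun y => sub_nonneg.2 (h1 y)) (fun y => by linarith [h0 y])
    (by rw [integral_sub (integrable_const _) (hYB.integrable μ)]; simp; linarith) ht
  refine (measureReal_mono fun ω hω => ?_).trans this
  simp only [Set.mem_ofPred_eq, Finset.sum_sub_distrib, Finset.sum_const, Finset.card_univ,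
    Fintype.card_fin, nsmul_eq_mul] at hω ⊢
  linarith

theorem integral_sum_pi {n : ℕ} {φ : Ω → ℝ} (hφ : Integrable φ μ) :
    Integrable (fun ω : Fin n → Ω => ∑ j, φ (ω j)) (Measure.pi fun _ : Fin n => μ) ∧
    ∫ ω, ∑ j, φ (ω j) ∂(Measure.pi fun _ : Fin n => μ) = n * ∫ y, φ y ∂μ := by
  have hi : ∀ j : Fin n, Integrable (fun ω : Fin n → Ω => φ (ω j))
      (Measure.pi fun _ : Fin n => μ) := fun j =>
    (measurePreserving_eval (fun _ : Fin n => μ) j).integrable_comp_of_integrable hφ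
  refine ⟨integrable_finsetSum _ fun j _ => hi j, ?_⟩
  rw [integral_finsetSum _ fun j _ => hi j]
  have : ∀ j : Fin n, ∫ ω : Fin n → Ω, φ (ω j) ∂(Measure.pi fun _ : Fin n => μ) =
      ∫ y, φ y ∂μ := fun j => by
    have hmp := measurePreserving_eval (fun _ : Fin n => μ) j
    have h := integral_map (μ := Measure.pi fun _ : Fin n => μ) (φ := Function.eval j) (f := φ)
      hmp.measurable.aemeasurable (by rw [hmp.map_eq]; exact hφ.aestronglyMeasurable)
    rw [hmp.map_eq] at h
    exact h.symm
  simp [this]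

/-- Exponential moments from a bound on the resampling variance that holds up to a rare event and
a term with small exponential moments. -/
theorem integral_exp_le_of_resamplingVar_le {n : ℕ} {Z R : (Fin n → Ω) → ℝ} {D L K Q v v' δ ρ : ℝ}
    (hZm : Measurable Z) (hZ : ∀ ω, |Z ω| ≤ D) (hR : BddMeas R) {S : Set (Fin n → Ω)}
    (hS : MeasurableSet S) (hL : 0 < L) (hK : 1 < K) (hQ : 0 ≤ Q)
    (hmean : 0 ≤ ∫ ω, Z ω ∂(Measure.pi fun _ : Fin n => μ))
    (hV : ∀ᵐ ω ∂(Measure.pi fun _ : Fin n => μ),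
      resamplingVar μ Z ω ≤ v + S.indicator (fun _ => Q) ω + R ω)
    (hbad : Q * Real.exp (L * D) * (Measure.pi fun _ : Fin n => μ).real S ≤ δ)
    (hRlog : ∀ l, 0 < l → l ≤ L → Real.log (∫ ω, Real.exp (K * l ^ 2 * R ω)
      ∂(Measure.pi fun _ : Fin n => μ)) ≤ K * l ^ 2 * ρ)
    (hv' : v + δ + ρ ≤ v' * (1 - 1 / K)) :
    ∫ ω, Real.exp (L * Z ω) ∂(Measure.pi fun _ : Fin n => μ) ≤
      Real.exp (L * ∫ ω, Z ω ∂(Measure.pi fun _ : Fin n => μ) + v' * L ^ 2) := by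
  set ν := Measure.pi fun _ : Fin n => μ with hν
  have hZB : BddMeas Z := ⟨hZm, D, hZ⟩
  refine integral_exp_le_of_expEntropy_le ν hZB hL fun l hl hlL => ?_
  have hlZ : BddMeas fun ω => l * Z ω := (BddMeas.const l).mul hZB
  set M := ∫ ω, Real.exp (l * Z ω) ∂ν with hM
  have hM0 : 0 < M := integral_exp_pos' ν hlZ
  -- Nonnegativity of the mean enters here; it lets an additive error be charged to `M`.
  have hM1 : 1 ≤ M := by
    have : Real.exp (∫ ω, l * Z ω ∂ν) ≤ M :=
      convexOn_exp.map_integral_le Real.continuous_exp.continuousOn isClosed_univ (by simp)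
        (hlZ.integrable ν) (hlZ.exp.integrable ν)
    refine le_trans (Real.one_le_exp ?_) this
    rw [integral_const_mul]
    positivity
  have hvar : ∀ ω, resamplingVar μ (fun ω => l * Z ω) ω = l ^ 2 * resamplingVar μ Z ω := by
    intro ω
    simp only [resamplingVar, Finset.mul_sum]
    refine Finset.sum_congr rfl fun j _ => ?_
    rw [← integral_const_mul]
    congr 1; ext y
    rw [← mul_sub, ← mul_pow, mul_max_of_nonneg _ _ hl.le, mul_zero]
  have hent := expEntropy_pi_le μ hlZ
  rw [← hν] at hent
  simp_rw [hvar] at hent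
  have hindB : BddMeas (S.indicator fun _ => Q) := by
    refine ⟨measurable_const.indicator hS, Q, fun ω => ?_⟩
    by_cases h : ω ∈ S
    · simp [h, abs_of_nonneg hQ]
    · simp [h, hQ]
  have iE := hlZ.exp
  have hTB : BddMeas fun ω => K * l ^ 2 * R ω := (BddMeas.const _).mul hR
  have hmaj : ∫ ω, Real.exp (l * Z ω) * (l ^ 2 * resamplingVar μ Z ω) ∂ν ≤
      ∫ ω, (l ^ 2 * v * Real.exp (l * Z ω) + (l ^ 2 * Real.exp (L * D)) * S.indicator (fun _ => Q) ω
        + 1 / K * (Real.exp (l * Z ω) * (K * l ^ 2 * R ω))) ∂ν := by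
    refine integral_mono_ae
      ((iE.mul ((BddMeas.const _).mul (hZB.resamplingVar μ))).integrable ν)
      (((((BddMeas.const _).mul iE).add ((BddMeas.const _).mul hindB)).add
        ((BddMeas.const _).mul (iE.mul hTB))).integrable ν) ?_
    filter_upwards [hV] with ω hω
    have hS0 : 0 ≤ S.indicator (fun _ => Q) ω := Set.indicator_nonneg (fun _ _ => hQ) ω
    have he : Real.exp (l * Z ω) ≤ Real.exp (L * D) := by
      refine Real.exp_le_exp.2 ?_
      have h1 := (le_abs_self _).trans (hZ ω)
      have h2 := (abs_nonneg _).trans (hZ ω)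
      nlinarith
    have h1 : Real.exp (l * Z ω) * (l ^ 2 * resamplingVar μ Z ω) ≤
        Real.exp (l * Z ω) * (l ^ 2 * (v + S.indicator (fun _ => Q) ω + R ω)) := by gcongr
    have h2 : l ^ 2 * (Real.exp (l * Z ω) * S.indicator (fun _ => Q) ω) ≤
        l ^ 2 * (Real.exp (L * D) * S.indicator (fun _ => Q) ω) := by gcongr
    have h3 : 1 / K * (Real.exp (l * Z ω) * (K * l ^ 2 * R ω)) =
        Real.exp (l * Z ω) * (l ^ 2 * R ω) := by field_simp
    rw [h3]
    linarith
  have hi1 := ((BddMeas.const (l ^ 2 * v)).mul iE).integrable ν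
  have hi2 := ((BddMeas.const (l ^ 2 * Real.exp (L * D))).mul hindB).integrable ν
  have hi3 := ((BddMeas.const (1 / K)).mul (iE.mul hTB)).integrable ν
  have hi12 := (((BddMeas.const (l ^ 2 * v)).mul iE).add
    ((BddMeas.const (l ^ 2 * Real.exp (L * D))).mul hindB)).integrable ν
  rw [integral_add hi12 hi3, integral_add hi1 hi2, integral_const_mul, integral_const_mul,
    integral_const_mul, integral_indicator_const _ hS, smul_eq_mul] at hmaj
  have hgibbs := integral_exp_mul_le ν hlZ hTB
  rw [← hM] at hgibbs hmaj
  have hlog := mul_le_mul_of_nonneg_left (hRlog l hl hlL) hM0.le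
  have hK0 : 0 < K := by linarith
  -- The Gibbs inequality decouples `R` from `e^{lZ}` at the price of a fraction `1 / K` of the
  -- entropy being estimated; moving it to the left explains the factor `1 - 1 / K` in `hv'`.
  have hG : 1 / K * ∫ ω, Real.exp (l * Z ω) * (K * l ^ 2 * R ω) ∂ν ≤
      1 / K * expEntropy ν (fun ω => l * Z ω) + M * l ^ 2 * ρ := by
    have := mul_le_mul_of_nonneg_left (hgibbs.trans (add_le_add_right hlog _))
      (one_div_pos.2 hK0).le
    refine this.trans_eq ?_
    field_simp
  have hbad' : l ^ 2 * Real.exp (L * D) * (ν.real S * Q) ≤ l ^ 2 * δ * M := by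
    have h1 : l ^ 2 * (Q * Real.exp (L * D) * ν.real S) ≤ l ^ 2 * δ := by gcongr
    have h2 : 0 ≤ l ^ 2 * δ := le_trans (by positivity) h1
    nlinarith
  have h1 : expEntropy ν (fun ω => l * Z ω) * (1 - 1 / K) ≤ (v + δ + ρ) * (l ^ 2 * M) := by
    nlinarith [hent.trans hmaj]
  have h2 : (v + δ + ρ) * (l ^ 2 * M) ≤ v' * (1 - 1 / K) * (l ^ 2 * M) := by gcongr
  have h3 : 0 < 1 - 1 / K := by
    rw [sub_pos, div_lt_one hK0]; exact hK
  refine le_of_mul_le_mul_right ?_ h3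
  linarith

end Sample

/-! ### Envelope and brackets for the squares. -/

section Brackets

variable {Ω : Type*} [MeasurableSpace Ω]

theorem integral_sq_le_of_eLpNorm_le {P : Measure Ω} {f : Ω → ℝ} {ε : ℝ} (hε : 0 ≤ ε)
    (hf : MemLp f 2 P) (h : eLpNorm f 2 P ≤ ENNReal.ofReal ε) : ∫ ω, f ω ^ 2 ∂P ≤ ε ^ 2 := by
  rw [hf.eLpNorm_eq_integral_rpow_norm (by norm_num) (by norm_num),
    ENNReal.ofReal_le_ofReal_iff hε] at h
  have h0 : 0 ≤ ∫ ω, f ω ^ 2 ∂P := integral_nonneg fun _ => sq_nonneg _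
  simp only [ENNReal.toReal_ofNat, Real.rpow_ofNat, Real.norm_eq_abs, sq_abs] at h
  have h2 := pow_le_pow_left₀ (by positivity) h 2
  rwa [← Real.rpow_natCast, ← Real.rpow_mul h0, Nat.cast_ofNat, inv_mul_cancel₀ two_ne_zero,
    Real.rpow_one] at h2

/-- Young's inequality with weight `ε`: the square moves by a factor near one, and the large
constant falls only on the squared bracket width. -/
theorem sq_add_le_of_abs_le {ε x y d : ℝ} (hε : 0 < ε) (h : |x - y| ≤ d) :
    x ^ 2 ≤ (1 + ε) * y ^ 2 + (1 + 1 / ε) * d ^ 2 := by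
  have h1 : (x - y) ^ 2 ≤ d ^ 2 := by
    rw [← sq_abs]; exact pow_le_pow_left₀ (abs_nonneg _) h 2
  have h2 : 0 ≤ (ε * y - (x - y)) ^ 2 / ε := by positivity
  have h3 : (ε * y - (x - y)) ^ 2 / ε = ε * y ^ 2 - 2 * y * (x - y) + 1 / ε * (x - y) ^ 2 := by
    field_simp
    ring
  have h4 := mul_le_mul_of_nonneg_left h1 (show 0 ≤ 1 + 1 / ε by positivity)
  nlinarith

/-- A family with finite `L₂` bracketing numbers has a square integrable envelope, and the squares
of its members are bracketed by finitely many pairs with almost the same expectation. -/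
theorem exists_envelope_of_bracketing (P : Measure Ω) [IsProbabilityMeasure P] {𝔛 : Set (Ω → ℝ)}
    (hmeas : ∀ X ∈ 𝔛, Measurable X)
    (hnormalized : ∀ X ∈ 𝔛, Integrable (fun ω => X ω ^ 2) P ∧ ∫ ω, X ω ^ 2 ∂P = 1)
    (hbracket : ∀ ε : ℝ, 0 < ε → bracketingNumber P 𝔛 ε < ⊤) {δ : ℝ} (hδ : 0 < δ) (hδ1 : δ ≤ 1) :
    ∃ F : Ω → ℝ, Measurable F ∧ (∀ ω, 0 ≤ F ω) ∧ Integrable (fun ω => F ω ^ 2) P ∧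
      (∀ X ∈ 𝔛, ∀ ω, |X ω| ≤ F ω) ∧
      ∃ 𝒦 : Finset ((Ω → ℝ) × (Ω → ℝ)),
        (∀ p ∈ 𝒦, Measurable p.1 ∧ Measurable p.2 ∧ (∀ ω, 0 ≤ p.1 ω ∧ p.1 ω ≤ F ω ^ 2) ∧
          (∀ ω, 0 ≤ p.2 ω ∧ p.2 ω ≤ F ω ^ 2) ∧ 1 - δ ≤ ∫ ω, p.1 ω ∂P ∧ ∫ ω, p.2 ω ∂P ≤ 1 + δ) ∧
        ∀ X ∈ 𝔛, ∃ p ∈ 𝒦, ∀ ω, p.1 ω ≤ X ω ^ 2 ∧ X ω ^ 2 ≤ p.2 ω := by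
  classical
  -- The width then costs `(1 + 1 / ε) ε ^ 2 = ε + ε ^ 2`, and all losses together stay below `4ε =
  -- δ`.
  set ε : ℝ := δ / 4 with hεdef
  have hε : 0 < ε := by positivity
  obtain ⟨B, hB⟩ := iInf_lt_iff.1 (hbracket ε hε)
  obtain ⟨⟨hB1, hB2⟩, -⟩ := iInf_lt_iff.1 hB
  set F : Ω → ℝ := fun ω => ∑ b ∈ B, (|b.1 ω| + |b.2 ω|) with hF
  have hFm : Measurable F := Finset.measurable_fun_sum _ fun b hb => by
    obtain ⟨h1, h2, -⟩ := hB1 b hb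
    exact h1.abs.add h2.abs
  have hF0 : ∀ ω, 0 ≤ F ω := fun ω => Finset.sum_nonneg fun b _ => by positivity
  have hFb : ∀ b ∈ B, ∀ ω, |b.1 ω| + |b.2 ω| ≤ F ω := fun b hb ω =>
    Finset.single_le_sum (f := fun b : (Ω → ℝ) × (Ω → ℝ) => |b.1 ω| + |b.2 ω|)
      (fun b _ => by positivity) hb
  have hF2 : MemLp F 2 P := memLp_finsetSum _ fun b hb => by
    obtain ⟨-, -, h1, h2, -⟩ := hB1 b hb
    exact h1.abs.add h2.abs
  have hFint : Integrable (fun ω => F ω ^ 2) P :=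
    (memLp_two_iff_integrable_sq hFm.aestronglyMeasurable).1 hF2
  have hXF : ∀ X ∈ 𝔛, ∀ ω, |X ω| ≤ F ω := fun X hX ω => by
    obtain ⟨b, hb, h1, h2⟩ := hB2 X hX
    have := hFb b hb ω
    have := neg_abs_le (b.1 ω)
    have := le_abs_self (b.2 ω)
    have := abs_nonneg (b.1 ω)
    have := abs_nonneg (b.2 ω)
    exact abs_le.2 ⟨by linarith [h1 ω], by linarith [h2 ω]⟩
  -- The brackets for squares are built around a member of the family in each bracket, because
  -- members have second moment exactly one while bracket endpoints do not. The default `0` is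
  -- discarded later by the filter.
  let rep : (Ω → ℝ) × (Ω → ℝ) → Ω → ℝ := fun b =>
    if h : ∃ X ∈ 𝔛, b.1 ≤ X ∧ X ≤ b.2 then h.choose else 0
  let lo : (Ω → ℝ) × (Ω → ℝ) → Ω → ℝ := fun b ω =>
    max ((rep b ω ^ 2 - (1 + 1 / ε) * (b.2 ω - b.1 ω) ^ 2) / (1 + ε)) 0
  -- Capping at `F ^ 2` makes the bracket bounded by `M ^ 2` on `F ≤ M`, as Hoeffding's inequality
  -- requires.
  let hi : (Ω → ℝ) × (Ω → ℝ) → Ω → ℝ := fun b ω =>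
    min ((1 + ε) * rep b ω ^ 2 + (1 + 1 / ε) * (b.2 ω - b.1 ω) ^ 2) (F ω ^ 2)
  refine ⟨F, hFm, hF0, hFint, hXF,
    (B.filter fun b => ∃ X ∈ 𝔛, b.1 ≤ X ∧ X ≤ b.2).image fun b => (lo b, hi b), ?_, ?_⟩
  · intro p hp
    obtain ⟨b, hb, rfl⟩ := Finset.mem_image.1 hp
    obtain ⟨hbB, hex⟩ := Finset.mem_filter.1 hb
    have hrep : rep b = hex.choose := dif_pos hex
    have hR𝔛 : rep b ∈ 𝔛 := hrep ▸ hex.choose_spec.1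
    obtain ⟨hl, hu, hl2, hu2, hlu⟩ := hB1 b hbB
    have hRm := hmeas _ hR𝔛
    obtain ⟨hRi, hR1⟩ := hnormalized _ hR𝔛
    have hdm : Measurable fun ω => b.2 ω - b.1 ω := hu.sub hl
    have hd2 : MemLp (fun ω => b.2 ω - b.1 ω) 2 P := hu2.sub hl2
    have hdi : Integrable (fun ω => (b.2 ω - b.1 ω) ^ 2) P :=
      (memLp_two_iff_integrable_sq hdm.aestronglyMeasurable).1 hd2
    have hdε : ∫ ω, (b.2 ω - b.1 ω) ^ 2 ∂P ≤ ε ^ 2 := integral_sq_le_of_eLpNorm_le hε.le hd2 hlu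
    have hRF : ∀ ω, rep b ω ^ 2 ≤ F ω ^ 2 := fun ω => by
      rw [← sq_abs]; exact pow_le_pow_left₀ (abs_nonneg _) (hXF _ hR𝔛 ω) 2
    have hlom : Measurable (lo b) :=
      (((hRm.pow_const 2).sub ((hdm.pow_const 2).const_mul _)).div_const _).max measurable_const
    have hhim : Measurable (hi b) :=
      (((hRm.pow_const 2).const_mul _).add ((hdm.pow_const 2).const_mul _)).min (hFm.pow_const 2)
    have hlo0 : ∀ ω, 0 ≤ lo b ω := fun ω => le_max_right _ _
    have hloF : ∀ ω, lo b ω ≤ F ω ^ 2 := fun ω => by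
      refine max_le ?_ (sq_nonneg _)
      rw [div_le_iff₀ (by positivity)]
      have : 0 ≤ (1 + 1 / ε) * (b.2 ω - b.1 ω) ^ 2 := by positivity
      nlinarith [hRF ω, sq_nonneg (F ω)]
    have hhi0 : ∀ ω, 0 ≤ hi b ω := fun ω => le_min (by positivity) (sq_nonneg _)
    have hhiF : ∀ ω, hi b ω ≤ F ω ^ 2 := fun ω => min_le_right _ _
    have hI : ∀ f : Ω → ℝ, Measurable f → (∀ ω, 0 ≤ f ω) → (∀ ω, f ω ≤ F ω ^ 2) →
        Integrable f P := fun f hf h0 h1 =>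
      hFint.mono' hf.aestronglyMeasurable (ae_of_all _ fun ω => by
        rw [Real.norm_eq_abs, abs_of_nonneg (h0 ω)]; exact h1 ω)
    have hε1 : (1 + 1 / ε) * ∫ ω, (b.2 ω - b.1 ω) ^ 2 ∂P ≤ ε ^ 2 + ε := by
      refine (mul_le_mul_of_nonneg_left hdε (by positivity)).trans_eq ?_
      field_simp
    have hi1 := hdi.const_mul (1 + 1 / ε)
    refine ⟨hlom, hhim, fun ω => ⟨hlo0 ω, hloF ω⟩, fun ω => ⟨hhi0 ω, hhiF ω⟩, ?_, ?_⟩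
    · have h1 : ∫ ω, (rep b ω ^ 2 - (1 + 1 / ε) * (b.2 ω - b.1 ω) ^ 2) / (1 + ε) ∂P ≤
          ∫ ω, lo b ω ∂P :=
        integral_mono ((hRi.sub hi1).div_const _) (hI _ hlom hlo0 hloF) fun ω => le_max_left _ _
      rw [integral_div, integral_sub hRi hi1, hR1, integral_const_mul] at h1
      refine le_trans ?_ h1
      rw [le_div_iff₀ (by positivity)]
      nlinarith
    · have h1 : ∫ ω, hi b ω ∂P ≤
          ∫ ω, ((1 + ε) * rep b ω ^ 2 + (1 + 1 / ε) * (b.2 ω - b.1 ω) ^ 2) ∂P :=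
        integral_mono (hI _ hhim hhi0 hhiF) ((hRi.const_mul _).add hi1) fun ω => min_le_left _ _
      rw [integral_add (hRi.const_mul _) hi1, integral_const_mul, integral_const_mul, hR1] at h1
      show ∫ ω, hi b ω ∂P ≤ 1 + δ
      nlinarith
  · intro X hX
    obtain ⟨b, hb, h1, h2⟩ := hB2 X hX
    have hex : ∃ X ∈ 𝔛, b.1 ≤ X ∧ X ≤ b.2 := ⟨X, hX, h1, h2⟩
    refine ⟨(lo b, hi b), Finset.mem_image_of_mem _ (Finset.mem_filter.2 ⟨hb, hex⟩), fun ω => ?_⟩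
    have hrep : rep b = hex.choose := dif_pos hex
    have hR : b.1 ω ≤ rep b ω ∧ rep b ω ≤ b.2 ω := by
      rw [hrep]
      exact ⟨hex.choose_spec.2.1 ω, hex.choose_spec.2.2 ω⟩
    have hd : |X ω - rep b ω| ≤ b.2 ω - b.1 ω :=
      abs_le.2 ⟨by linarith [h1 ω, h2 ω], by linarith [h1 ω, h2 ω]⟩
    refine ⟨max_le ?_ (sq_nonneg _), le_min (sq_add_le_of_abs_le hε hd) ?_⟩
    · rw [div_le_iff₀ (by positivity)]
      have := sq_add_le_of_abs_le hε (abs_sub_comm (X ω) _ ▸ hd)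
      linarith
    · rw [← sq_abs]; exact pow_le_pow_left₀ (abs_nonneg _) (hXF X hX ω) 2

/-- The tails of an integrable function vanish. -/
theorem exists_forall_integral_tail_le (P : Measure Ω) [IsProbabilityMeasure P] {F : Ω → ℝ}
    (hF : Measurable F) (hF2 : Integrable (fun ω => F ω ^ 2) P) {τ : ℝ} (hτ : 0 < τ) :
    ∃ A, 0 < A ∧ ∀ a, A ≤ a → ∫ ω, {ω | a < F ω}.indicator (fun ω => F ω ^ 2) ω ∂P ≤ τ := by
  have hlim : Tendsto (fun a : ℝ => ∫ ω, {ω | a < F ω}.indicator (fun ω => F ω ^ 2) ω ∂P) atTop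
      (nhds (∫ _, (0 : ℝ) ∂P)) := by
    refine tendsto_integral_filter_of_dominated_convergence (fun ω => F ω ^ 2)
      (Eventually.of_forall fun a => ((hF.pow_const 2).indicator
        (measurableSet_lt measurable_const hF)).aestronglyMeasurable)
      (Eventually.of_forall fun a => ae_of_all _ fun ω => ?_) hF2 (ae_of_all _ fun ω => ?_)
    · refine (norm_indicator_le_norm_self _ _).trans_eq ?_
      rw [Real.norm_eq_abs, abs_of_nonneg (sq_nonneg _)]
    · refine tendsto_const_nhds.congr' ?_
      filter_upwards [eventually_ge_atTop (F ω)] with a ha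
      rw [Set.indicator_of_notMem]
      exact not_lt.2 ha
  rw [integral_zero] at hlim
  obtain ⟨A, hA⟩ := eventually_atTop.1 (hlim.eventually (gt_mem_nhds hτ))
  exact ⟨max A 1, by positivity, fun a ha => (hA a ((le_max_left _ _).trans ha)).le⟩

end Brackets

/-! ### The truncated class and its supremum. -/

section Truncation

theorem indicator_tail_le {Ω : Type*} {F : Ω → ℝ} {a : ℝ} (ha : 0 < a) (ω : Ω) : {ω | a < F ω}.indicator F ω ≤
    1 / a * {ω | a < F ω}.indicator (fun ω => F ω ^ 2) ω := by
  by_cases h : a < F ω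
  · rw [Set.indicator_of_mem (by exact h), Set.indicator_of_mem (by exact h), one_div,
      inv_mul_eq_div, le_div_iff₀ ha]
    nlinarith
  · rw [Set.indicator_of_notMem (by exact h), Set.indicator_of_notMem (by exact h), mul_zero]

theorem sq_trunc_eq {Ω : Type*} {F : Ω → ℝ} {a : ℝ} {n : ℕ} {X : Ω → ℝ} {s : ℝ} (hs : |s| = 1) (ω : Ω) :
    (s / √n * {ω | F ω ≤ a}.indicator X ω) ^ 2 =
      1 / n * {ω | F ω ≤ a}.indicator (fun ω => X ω ^ 2) ω := by
  rw [mul_pow, div_pow, Real.sq_sqrt (Nat.cast_nonneg n), ← sq_abs, hs, one_pow]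
  congr 1
  by_cases hω : F ω ≤ a
  · rw [Set.indicator_of_mem (by exact hω), Set.indicator_of_mem (by exact hω)]
  · rw [Set.indicator_of_notMem (by exact hω), Set.indicator_of_notMem (by exact hω)]
    simp

variable {Ω : Type*} [MeasurableSpace Ω]

/-- The truncated second moment `E[F²; F > a]`. -/
noncomputable def tailSq (P : Measure Ω) (F : Ω → ℝ) (a : ℝ) : ℝ :=
  ∫ ω, {ω | a < F ω}.indicator (fun ω => F ω ^ 2) ω ∂P

/-- Centered and normalized random variables with a square integrable envelope `F`. -/
structure IsEnveloped (P : Measure Ω) (𝔛 : Set (Ω → ℝ)) (F : Ω → ℝ) : Prop where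
  meas : ∀ X ∈ 𝔛, Measurable X
  centered : ∀ X ∈ 𝔛, Integrable X P ∧ ∫ ω, X ω ∂P = 0
  normalized : ∀ X ∈ 𝔛, Integrable (fun ω => X ω ^ 2) P ∧ ∫ ω, X ω ^ 2 ∂P = 1
  measF : Measurable F
  nonneg : ∀ ω, 0 ≤ F ω
  sq_integrable : Integrable (fun ω => F ω ^ 2) P
  le : ∀ X ∈ 𝔛, ∀ ω, |X ω| ≤ F ω

/-- The truncated and rescaled variables `± n^{-1/2} X 1{F ≤ a}`. -/
def truncClass (𝔛 : Set (Ω → ℝ)) (F : Ω → ℝ) (a : ℝ) (n : ℕ) : Set (Ω → ℝ) :=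
  {h | ∃ X ∈ 𝔛, ∃ s : ℝ, |s| = 1 ∧ h = fun ω => s / √n * {ω | F ω ≤ a}.indicator X ω}

namespace IsEnveloped

variable {P : Measure Ω} {𝔛 : Set (Ω → ℝ)} {F : Ω → ℝ}

theorem measurableSet_gt (hE : IsEnveloped P 𝔛 F) (a : ℝ) : MeasurableSet {ω | a < F ω} :=
  measurableSet_lt measurable_const hE.measF

theorem measurableSet_le (hE : IsEnveloped P 𝔛 F) (a : ℝ) : MeasurableSet {ω | F ω ≤ a} :=
  _root_.measurableSet_le hE.measF measurable_const

theorem integrable_of_le (hE : IsEnveloped P 𝔛 F) {f : Ω → ℝ} (hf : Measurable f)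
    (h : ∀ ω, |f ω| ≤ F ω ^ 2) : Integrable f P :=
  hE.sq_integrable.mono' hf.aestronglyMeasurable (ae_of_all _ h)

theorem integrable_tail (hE : IsEnveloped P 𝔛 F) (a : ℝ) :
    Integrable ({ω | a < F ω}.indicator fun ω => F ω ^ 2) P :=
  hE.sq_integrable.indicator (hE.measurableSet_gt a)

theorem indicator_nonneg' (hE : IsEnveloped P 𝔛 F) (a : ℝ) (ω : Ω) :
    0 ≤ {ω | a < F ω}.indicator F ω :=
  Set.indicator_nonneg (fun _ _ => hE.nonneg _) _

theorem integrable_tail_one (hE : IsEnveloped P 𝔛 F) {a : ℝ} (ha : 0 < a) :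
    Integrable ({ω | a < F ω}.indicator F) P := by
  refine ((hE.integrable_tail a).const_mul (1 / a)).mono'
    (hE.measF.indicator (hE.measurableSet_gt a)).aestronglyMeasurable (ae_of_all _ fun ω => ?_)
  rw [Real.norm_eq_abs, abs_of_nonneg (hE.indicator_nonneg' a ω)]
  exact indicator_tail_le ha ω

theorem integral_tail_one_le (hE : IsEnveloped P 𝔛 F) {a : ℝ} (ha : 0 < a) :
    ∫ ω, {ω | a < F ω}.indicator F ω ∂P ≤ tailSq P F a / a := by
  refine (integral_mono (hE.integrable_tail_one ha) ((hE.integrable_tail a).const_mul (1 / a))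
    (indicator_tail_le ha)).trans_eq ?_
  rw [integral_const_mul, one_div_mul_eq_div, tailSq]

theorem measureReal_tail_le (hE : IsEnveloped P 𝔛 F) [IsProbabilityMeasure P] {a : ℝ}
    (ha : 0 < a) : P.real {ω | a < F ω} ≤ tailSq P F a / a ^ 2 := by
  rw [le_div_iff₀ (by positivity), ← smul_eq_mul,
    ← integral_indicator_const (a ^ 2) (hE.measurableSet_gt a)]
  refine integral_mono ((integrable_const _).indicator (hE.measurableSet_gt a))
    (hE.integrable_tail a) fun ω => ?_
  exact Set.indicator_le_indicator' fun h => pow_le_pow_left₀ ha.le (le_of_lt h) 2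

section

variable {a : ℝ} {n : ℕ}

theorem measurable_trunc (hE : IsEnveloped P 𝔛 F) {h : Ω → ℝ} (hh : h ∈ truncClass 𝔛 F a n) :
    Measurable h := by
  obtain ⟨X, hX, s, -, rfl⟩ := hh
  exact ((hE.meas X hX).indicator (hE.measurableSet_le a)).const_mul _

theorem abs_trunc_le (hE : IsEnveloped P 𝔛 F) (ha : 0 ≤ a) {h : Ω → ℝ}
    (hh : h ∈ truncClass 𝔛 F a n) (ω : Ω) : |h ω| ≤ a / √n := by
  obtain ⟨X, hX, s, hs, rfl⟩ := hh
  rw [abs_mul, abs_div, hs, abs_of_nonneg (Real.sqrt_nonneg _), one_div_mul_eq_div]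
  gcongr
  by_cases hω : F ω ≤ a
  · rw [Set.indicator_of_mem (by exact hω)]
    exact (hE.le X hX ω).trans hω
  · rw [Set.indicator_of_notMem (by exact hω)]
    simpa

theorem integral_sq_trunc_le (hE : IsEnveloped P 𝔛 F) {h : Ω → ℝ}
    (hh : h ∈ truncClass 𝔛 F a n) : ∫ ω, h ω ^ 2 ∂P ≤ 1 / n := by
  obtain ⟨X, hX, s, hs, rfl⟩ := hh
  obtain ⟨hi, h1⟩ := hE.normalized X hX
  simp_rw [sq_trunc_eq hs]
  rw [integral_const_mul]
  refine mul_le_of_le_one_right (by positivity) ?_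
  rw [← h1]
  exact integral_mono (hi.indicator (hE.measurableSet_le a)) hi
    fun ω => Set.indicator_le_self' (fun _ _ => sq_nonneg _) ω

/-- Since `X` is centered, the mean of its truncation is minus the mean of the removed part, and `F
≤ F ^ 2 / a` there. -/
theorem abs_integral_trunc_le (hE : IsEnveloped P 𝔛 F) (ha : 0 < a) {h : Ω → ℝ}
    (hh : h ∈ truncClass 𝔛 F a n) : |∫ ω, h ω ∂P| ≤ 1 / √n * (tailSq P F a / a) := by
  obtain ⟨X, hX, s, hs, rfl⟩ := hh
  obtain ⟨hi, h0⟩ := hE.centered X hX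
  rw [integral_const_mul, abs_mul, abs_div, hs, abs_of_nonneg (Real.sqrt_nonneg _)]
  gcongr
  have hcompl : {ω | a < F ω} = {ω | F ω ≤ a}ᶜ := by ext; simp
  have hsplit := integral_add_compl (hE.measurableSet_le a) hi
  rw [h0, ← hcompl] at hsplit
  rw [integral_indicator (hE.measurableSet_le a), eq_neg_of_add_eq_zero_left hsplit, abs_neg,
    ← integral_indicator (hE.measurableSet_gt a)]
  refine (abs_integral_le_integral_abs).trans ((integral_mono
    (hi.indicator (hE.measurableSet_gt a)).abs (hE.integrable_tail_one ha) fun ω => ?_).trans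
    (hE.integral_tail_one_le ha))
  by_cases hω : a < F ω
  · simpa only [Set.indicator_of_mem (show ω ∈ {ω | a < F ω} from hω)] using hE.le X hX ω
  · simp only [Set.indicator_of_notMem (show ω ∉ {ω | a < F ω} from hω)]
    simp

end

/-- A measurable majorant of the supremum of the truncated process, with controlled expectation and
sub-Gaussian exponential moments. -/
theorem exists_majorant (hE : IsEnveloped P 𝔛 F) [IsProbabilityMeasure P] (hne : 𝔛.Nonempty)
    {a M δ : ℝ} {n : ℕ} (hn : 0 < n) (hM : 0 < M) (hMa : M ≤ a) (hδ : 0 < δ) (hδ1 : δ < 1)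
    (hτM : tailSq P F M ≤ δ) (hτa : tailSq P F a ≤ δ) {𝒦 : Finset ((Ω → ℝ) × (Ω → ℝ))}
    (h𝒦 : ∀ p ∈ 𝒦, Measurable p.2 ∧ (∀ ω, 0 ≤ p.2 ω ∧ p.2 ω ≤ F ω ^ 2) ∧
      ∫ ω, p.2 ω ∂P ≤ 1 + δ)
    (hX𝒦 : ∀ X ∈ 𝔛, ∃ p ∈ 𝒦, ∀ ω, X ω ^ 2 ≤ p.2 ω) :
    ∃ Z : (Fin n → Ω) → ℝ, BddMeas Z ∧
      (∀ h ∈ truncClass 𝔛 F a n, ∀ ω, ∑ j, h (ω j) ≤ Z ω) ∧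
      (∀ C' : ℝ, 0 ≤ C' → outerExpectation (sampleLaw P n) (fun ω =>
          ⨆ X ∈ 𝔛, ENNReal.ofReal |√n * empMean X ω|) < ENNReal.ofReal C' →
        ∫ ω, Z ω ∂(sampleLaw P n) ≤ C' + √n * (tailSq P F a / a)) ∧
      ∀ L : ℝ, 0 < L → L ^ 2 * (a / √n) ^ 2 ≤ δ →
        M ^ 2 * Real.exp (L * (n * (a / √n))) *
          (𝒦.card * Real.exp (-(2 * δ ^ 2 / (M ^ 2) ^ 2 * n))) ≤ δ →
        ∫ ω, Real.exp (L * Z ω) ∂(sampleLaw P n) ≤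
          Real.exp (L * ∫ ω, Z ω ∂(sampleLaw P n) + (2 + 7 * δ) / (1 - δ) * L ^ 2) := by
  have ha : 0 < a := hM.trans_le hMa
  have hn' : (0 : ℝ) < n := by exact_mod_cast hn
  have hsn : 0 < √(n : ℝ) := Real.sqrt_pos.2 hn'
  have hsq : √(n : ℝ) * √n = n := Real.mul_self_sqrt hn'.le
  have hHne : (truncClass 𝔛 F a n).Nonempty := by
    obtain ⟨X, hX⟩ := hne
    exact ⟨_, X, hX, 1, abs_one, rfl⟩
  obtain ⟨Z, hZm, hZb, hZH, hZmin, hZV⟩ := exists_cover_sup_empirical P n hHne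
    (fun h hh => hE.abs_trunc_le ha.le hh) fun h hh => hE.measurable_trunc hh
  -- The signs make the class symmetric, whence `Z ≥ 0`.
  have hneg : ∀ h ∈ truncClass 𝔛 F a n, (fun ω => -h ω) ∈ truncClass 𝔛 F a n := by
    rintro _ ⟨X, hX, s, hs, rfl⟩
    exact ⟨X, hX, -s, by rwa [abs_neg], by ext ω; ring⟩
  have hZ0 : ∀ ω, 0 ≤ Z ω := fun ω => by
    obtain ⟨h, hh⟩ := hHne
    have h1 := hZH h hh ω
    have h2 := hZH _ (hneg h hh) ω
    rw [Finset.sum_neg_distrib] at h2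
    linarith
  have hZB : BddMeas Z := ⟨hZm, _, hZb⟩
  refine ⟨Z, hZB, hZH, fun C' hC' hout => ?_, fun L hL hLa hbad => ?_⟩
  · obtain ⟨G, hG⟩ := iInf_lt_iff.1 hout
    obtain ⟨hGm, hG⟩ := iInf_lt_iff.1 hG
    obtain ⟨hGle, hG⟩ := iInf_lt_iff.1 hG
    have hGfin : ∀ᵐ ω ∂(sampleLaw P n), G ω < ⊤ :=
      ae_lt_top hGm (hG.trans ENNReal.ofReal_lt_top).ne
    set T : (Fin n → Ω) → ℝ := fun ω => ∑ j, {ω | a < F ω}.indicator F (ω j) with hT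
    have hTm : Measurable T := Finset.measurable_fun_sum _ fun j _ =>
      (hE.measF.indicator (hE.measurableSet_gt a)).comp (measurable_pi_apply j)
    obtain ⟨hTi, hTe⟩ := integral_sum_pi P (n := n) (hE.integrable_tail_one ha)
    -- Any measurable majorant `G` of the untruncated supremum, corrected by the removed tails `T`,
    -- competes with `Z`. Where `G` is infinite, a null set, the uniform bound on `Z` is used.
    have hle := hZmin (fun ω => if G ω = ⊤ then n * (a / √n) else (G ω).toReal + 1 / √n * T ω)
      (Measurable.ite (hGm (measurableSet_singleton _)) measurable_const
        (hGm.ennreal_toReal.add (hTm.const_mul _))) (by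
        rintro _ hh ω
        split_ifs with hω
        · exact (hZH _ hh ω).trans ((le_abs_self _).trans (hZb ω))
        · obtain ⟨X, hX, s, hs, rfl⟩ := hh
          have h1 : |√n * empMean X ω| ≤ (G ω).toReal := by
            rw [← ENNReal.ofReal_le_iff_le_toReal hω]
            exact (le_iSup₂_of_le X hX le_rfl).trans (hGle ω)
          have h2 : √n * empMean X ω = 1 / √n * ∑ j, X (ω j) := by
            rw [empMean, ← mul_assoc]; congr 1; field_simp; nlinarith
          have h3 : ∀ y, |{ω | F ω ≤ a}.indicator X y - X y| ≤ {ω | a < F ω}.indicator F y := by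
            intro y
            by_cases hy : F y ≤ a
            · rw [Set.indicator_of_mem (by exact hy), sub_self, abs_zero]
              exact hE.indicator_nonneg' a y
            · rw [Set.indicator_of_notMem (by exact hy), Set.indicator_of_mem
                (show y ∈ {ω | a < F ω} from not_le.1 hy), zero_sub, abs_neg]
              exact hE.le X hX y
          have h4 : |∑ j, {ω | F ω ≤ a}.indicator X (ω j) - ∑ j, X (ω j)| ≤ T ω := by
            rw [← Finset.sum_sub_distrib]
            exact (Finset.abs_sum_le_sum_abs _ _).trans (Finset.sum_le_sum fun j _ => h3 _)
          rw [h2, abs_mul, abs_of_pos (by positivity)] at h1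
          rw [← Finset.mul_sum]
          have h5 : |∑ j, {ω | F ω ≤ a}.indicator X (ω j)| ≤ |∑ j, X (ω j)| + T ω := by
            have := abs_sub_abs_le_abs_sub (∑ j, {ω | F ω ≤ a}.indicator X (ω j)) (∑ j, X (ω j))
            linarith
          calc s / √n * ∑ j, {ω | F ω ≤ a}.indicator X (ω j)
              ≤ |s / √n * ∑ j, {ω | F ω ≤ a}.indicator X (ω j)| := le_abs_self _
            _ = 1 / √n * |∑ j, {ω | F ω ≤ a}.indicator X (ω j)| := by
              rw [abs_mul, abs_div, hs, abs_of_pos hsn]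
            _ ≤ 1 / √n * (|∑ j, X (ω j)| + T ω) := by gcongr
            _ ≤ _ := by linarith)
    have hGi : Integrable (fun ω => (G ω).toReal) (sampleLaw P n) :=
      integrable_toReal_of_lintegral_ne_top hGm.aemeasurable
        (hG.trans ENNReal.ofReal_lt_top).ne
    have h1 : ∫ ω, Z ω ∂(sampleLaw P n) ≤ ∫ ω, ((G ω).toReal + 1 / √n * T ω) ∂(sampleLaw P n) := by
      refine integral_mono_ae (hZB.integrable _) (hGi.add (hTi.const_mul _)) ?_
      filter_upwards [hle, hGfin] with ω h1 h2
      simpa [h2.ne] using h1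
    rw [integral_add hGi (hTi.const_mul _), integral_const_mul, hTe,
      integral_toReal hGm.aemeasurable hGfin] at h1
    have h2 : (∫⁻ ω, G ω ∂(sampleLaw P n)).toReal ≤ C' := ENNReal.toReal_le_of_le_ofReal hC' hG.le
    have h3 : 1 / √n * (n * ∫ y, {ω | a < F ω}.indicator F y ∂P) ≤ √n * (tailSq P F a / a) := by
      have : 1 / √n * (n * ∫ y, {ω | a < F ω}.indicator F y ∂P) =
          √n * ∫ y, {ω | a < F ω}.indicator F y ∂P := by
        rw [← mul_assoc]; congr 1; field_simp; nlinarith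
      rw [this]
      exact mul_le_mul_of_nonneg_left (hE.integral_tail_one_le ha) hsn.le
    linarith
  -- The middle range, where Hoeffding's inequality would lose too much since `a` grows with `n`;
  -- its mean is at most `δ` by the choice of `M`.
  · set r : Ω → ℝ := ({ω | M < F ω} ∩ {ω | F ω ≤ a}).indicator fun ω => F ω ^ 2 with hr
    have hr0 : ∀ y, 0 ≤ r y := fun y => Set.indicator_nonneg (fun _ _ => sq_nonneg _) y
    have hra : ∀ y, r y ≤ a ^ 2 := fun y => by
      refine Set.indicator_apply_le' (fun hy => ?_) fun _ => sq_nonneg _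
      exact pow_le_pow_left₀ (hE.nonneg y) hy.2 2
    have hrB : BddMeas r := ⟨(hE.measF.pow_const 2).indicator
      ((hE.measurableSet_gt M).inter (hE.measurableSet_le a)), a ^ 2, fun y => by
        rw [abs_of_nonneg (hr0 y)]; exact hra y⟩
    have hrint : ∫ y, r y ∂P ≤ δ := by
      refine (integral_mono (hrB.integrable P) (hE.integrable_tail M) fun y => ?_).trans hτM
      exact Set.indicator_le_indicator_of_subset Set.inter_subset_left (fun _ => sq_nonneg _) y
    set Y : (Ω → ℝ) × (Ω → ℝ) → Ω → ℝ := fun p => {ω | F ω ≤ M}.indicator p.2 with hY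
    have hYm : ∀ p ∈ 𝒦, Measurable (Y p) := fun p hp =>
      (h𝒦 p hp).1.indicator (hE.measurableSet_le M)
    have hY0 : ∀ p ∈ 𝒦, ∀ y, 0 ≤ Y p y := fun p hp y =>
      Set.indicator_nonneg (fun _ _ => ((h𝒦 p hp).2.1 _).1) y
    have hYM : ∀ p ∈ 𝒦, ∀ y, Y p y ≤ M ^ 2 := fun p hp y => by
      refine Set.indicator_apply_le' (fun hy => ?_) fun _ => sq_nonneg _
      exact ((h𝒦 p hp).2.1 y).2.trans (pow_le_pow_left₀ (hE.nonneg y) hy 2)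
    have hYint : ∀ p ∈ 𝒦, ∫ y, Y p y ∂P ≤ 1 + δ := fun p hp => by
      obtain ⟨hpm, hp0, hp1⟩ := h𝒦 p hp
      have hpi : Integrable p.2 P := hE.integrable_of_le hpm fun ω => by
        rw [abs_of_nonneg (hp0 ω).1]; exact (hp0 ω).2
      refine (integral_mono (hpi.indicator (hE.measurableSet_le M)) hpi fun y => ?_).trans hp1
      exact Set.indicator_le_self' (fun _ _ => (hp0 _).1) y
    set S : Set (Fin n → Ω) := ⋃ p ∈ 𝒦, {ω | n * (1 + δ + δ) ≤ ∑ j, Y p (ω j)} with hS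
    have hYsm : ∀ p ∈ 𝒦, Measurable fun ω : Fin n → Ω => ∑ j, Y p (ω j) := fun p hp =>
      Finset.measurable_fun_sum _ fun j _ => (hYm p hp).comp (measurable_pi_apply j)
    have hSm : MeasurableSet S := Finset.measurableSet_biUnion _ fun p hp =>
      _root_.measurableSet_le measurable_const (hYsm p hp)
    have hSP : (sampleLaw P n).real S ≤
        𝒦.card * Real.exp (-(2 * δ ^ 2 / (M ^ 2) ^ 2 * n)) := by
      refine (measureReal_biUnion_finset_le _ _).trans ((Finset.sum_le_card_nsmul _ _ _
        fun p hp => measureReal_sum_ge_le P (hYm p hp) (hY0 p hp) (hYM p hp) (hYint p hp)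
          hδ.le).trans_eq (nsmul_eq_mul _ _))
    set R : (Fin n → Ω) → ℝ := fun ω => 1 / n * ∑ j, r (ω j) with hR
    have hRB : BddMeas R := (BddMeas.const _).mul
      (BddMeas.sum fun j => hrB.comp (measurable_pi_apply j))
    -- In `v = 2 + 4δ`, `1 + 2δ` bounds the empirical second moment off `S` and `1 + 2δ` comes from
    -- the resampled copy and the cross term. Adding `δ` for `S` and `ρ = 2δ` gives `2 + 7δ`; `K = 1
    -- / δ` gives the denominator `1 - δ`.
    refine integral_exp_le_of_resamplingVar_le P (D := n * (a / √n)) (K := 1 / δ) (Q := M ^ 2)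
      (v := 2 + 4 * δ) (δ := δ) (ρ := 2 * δ) hZm hZb hRB hSm hL
      (by rwa [lt_div_iff₀ hδ, one_mul]) (sq_nonneg _) (integral_nonneg hZ0) ?_ ?_ ?_ ?_
    · refine hZV _ ((measurable_const.add (measurable_const.indicator hSm)).add hRB.meas) ?_
      intro h hh ω
      have hhB : BddMeas h := ⟨hE.measurable_trunc hh, _, hE.abs_trunc_le ha.le hh⟩
      have hterm : ∀ j, ∫ y, (h (ω j) - h y) ^ 2 ∂P ≤
          h (ω j) ^ 2 + (2 * tailSq P F a + 1) / n := by
        intro j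
        have e : ∫ y, (h (ω j) - h y) ^ 2 ∂P =
            h (ω j) ^ 2 - 2 * h (ω j) * ∫ y, h y ∂P + ∫ y, h y ^ 2 ∂P := by
          have e1 : ∀ y, (h (ω j) - h y) ^ 2 = h (ω j) ^ 2 - 2 * h (ω j) * h y + h y ^ 2 :=
            fun y => by ring
          simp_rw [e1]
          have i1 := (hhB.integrable P).const_mul (2 * h (ω j))
          have i2 : Integrable (fun y => h (ω j) ^ 2 - 2 * h (ω j) * h y) P :=
            (integrable_const _).sub i1
          rw [integral_add i2 (hhB.sq.integrable P), integral_sub (integrable_const _) i1,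
            integral_const_mul]
          simp
        have h1 := hE.abs_trunc_le ha.le hh (ω j)
        have h2 := hE.abs_integral_trunc_le ha hh
        have h3 := hE.integral_sq_trunc_le hh
        have h4 : |h (ω j) * ∫ y, h y ∂P| ≤ tailSq P F a / n := by
          rw [abs_mul]
          refine (mul_le_mul h1 h2 (abs_nonneg _) (by positivity)).trans_eq ?_
          have : a / √n * (1 / √n * (tailSq P F a / a)) = tailSq P F a / (√n * √n) := by
            field_simp
          rw [this, hsq]
        have h5 := neg_abs_le (h (ω j) * ∫ y, h y ∂P)
        have h6 : (2 * tailSq P F a + 1) / n = 2 * (tailSq P F a / n) + 1 / n := by ring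
        rw [e, h6]
        linarith
      obtain ⟨X, hX, s, hs, rfl⟩ := hh
      obtain ⟨p, hp, hXp⟩ := hX𝒦 X hX
      have hpt : ∀ y, {ω | F ω ≤ a}.indicator (fun ω => X ω ^ 2) y ≤ Y p y + r y := by
        intro y
        by_cases hya : F y ≤ a
        · rw [Set.indicator_of_mem (by exact hya)]
          by_cases hyM : F y ≤ M
          · have : Y p y = p.2 y := Set.indicator_of_mem (s := {ω | F ω ≤ M}) hyM _
            rw [this]
            linarith [hXp y, hr0 y]
          · have : r y = F y ^ 2 := Set.indicator_of_mem (s := {ω | M < F ω} ∩ {ω | F ω ≤ a})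
              ⟨not_le.1 hyM, hya⟩ _
            rw [this, ← sq_abs (X y)]
            have := pow_le_pow_left₀ (abs_nonneg _) (hE.le X hX y) 2
            linarith [hY0 p hp y]
        · rw [Set.indicator_of_notMem (by exact hya)]
          exact add_nonneg (hY0 p hp y) (hr0 y)
      have hYS : 1 / n * ∑ j, Y p (ω j) ≤ 1 + 2 * δ + S.indicator (fun _ => M ^ 2) ω := by
        rw [one_div_mul_eq_div, div_le_iff₀ hn']
        by_cases hω : ω ∈ S
        · rw [Set.indicator_of_mem hω]
          have : ∑ j, Y p (ω j) ≤ n * M ^ 2 := by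
            refine (Finset.sum_le_card_nsmul _ _ _ fun j _ => hYM p hp (ω j)).trans_eq ?_
            simp
          nlinarith
        · rw [Set.indicator_of_notMem hω]
          simp only [hS, Set.mem_iUnion, not_exists] at hω
          have : ∑ j, Y p (ω j) < n * (1 + δ + δ) := not_le.1 fun h => hω p hp h
          linarith
      calc ∑ j, ∫ y, (s / √n * {ω | F ω ≤ a}.indicator X (ω j) -
              s / √n * {ω | F ω ≤ a}.indicator X y) ^ 2 ∂P
          ≤ ∑ j, (1 / n * (Y p (ω j) + r (ω j)) + (2 * tailSq P F a + 1) / n) := by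
            refine Finset.sum_le_sum fun j _ => (hterm j).trans ?_
            simp only [sq_trunc_eq hs]
            gcongr
            exact hpt _
        _ = 1 / n * ∑ j, Y p (ω j) + R ω + (2 * tailSq P F a + 1) := by
            rw [Finset.sum_add_distrib, ← Finset.mul_sum, Finset.sum_add_distrib, hR]
            simp only [Finset.sum_const, Finset.card_univ, Fintype.card_fin, nsmul_eq_mul]
            field_simp
        _ ≤ _ := by linarith
    · refine le_trans ?_ hbad
      gcongr
    · intro l hl hlL
      have hc0 : 0 ≤ 1 / δ * l ^ 2 * (1 / n) := by positivity
      have := log_integral_exp_sum_le P (n := n) hrB (c := 1 / δ * l ^ 2 * (1 / n))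
        (fun y => mul_nonneg hc0 (hr0 y)) fun y => by
          calc 1 / δ * l ^ 2 * (1 / n) * r y ≤ 1 / δ * L ^ 2 * (1 / n) * a ^ 2 := by
                gcongr
                exacts [hr0 y, hra y]
            _ = 1 / δ * (L ^ 2 * (a / √n) ^ 2) := by
                rw [div_pow, Real.sq_sqrt hn'.le]; ring
            _ ≤ 1 / δ * δ := by gcongr
            _ = 1 := by field_simp
      simp only [hR, ← mul_assoc]
      refine this.trans ?_
      calc 2 * (1 / δ * l ^ 2 * (1 / n)) * (n * ∫ y, r y ∂P)
          = 1 / δ * l ^ 2 * (2 * ∫ y, r y ∂P) := by field_simp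
        _ ≤ 1 / δ * l ^ 2 * (2 * δ) := mul_le_mul_of_nonneg_left (by linarith) (by positivity)
        _ = _ := by ring
    · have : (1 : ℝ) - δ ≠ 0 := by linarith
      field_simp
      linarith

end IsEnveloped

end Truncation

/-! ### Reduction of the self-normalized event. -/

section SelfNorm

variable {Ω : Type*} [MeasurableSpace Ω] {P : Measure Ω} {𝔛 : Set (Ω → ℝ)} {F : Ω → ℝ}

theorem sqrt_mul_empMean {Ω : Type*} {n : ℕ} (hn : 0 < n) (X : Ω → ℝ) (ω : Fin n → Ω) :
    √n * empMean X ω = 1 / √n * ∑ j, X (ω j) := by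
  have hn' : (0 : ℝ) < n := by exact_mod_cast hn
  have : √(n : ℝ) * √n = n := Real.mul_self_sqrt hn'.le
  have hsn : 0 < √(n : ℝ) := Real.sqrt_pos.2 hn'
  rw [empMean, ← mul_assoc]
  congr 1
  field_simp
  nlinarith

/-- Large observations contribute to the normalized sum at most the square root of their number. -/
theorem abs_sqrt_mul_empMean_le {Ω : Type*} {𝔛 : Set (Ω → ℝ)} {F : Ω → ℝ} {a : ℝ} {n : ℕ} (hn : 0 < n)
    {X : Ω → ℝ} (hX : X ∈ 𝔛) {ω : Fin n → Ω} {z : ℝ}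
    (hz : ∀ h ∈ truncClass 𝔛 F a n, ∑ j, h (ω j) ≤ z) :
    |√n * empMean X ω| ≤
      z + √(empVar X ω) * √(∑ j, {ω | a < F ω}.indicator (fun _ => (1 : ℝ)) (ω j)) := by
  have hn' : (0 : ℝ) < n := by exact_mod_cast hn
  have hsn : 0 < √(n : ℝ) := Real.sqrt_pos.2 hn'
  set N := fun j => {ω | a < F ω}.indicator (fun _ => (1 : ℝ)) (ω j) with hN
  set U := ∑ j, {ω | F ω ≤ a}.indicator X (ω j) with hU
  have hsplit : ∑ j, X (ω j) = U + ∑ j, X (ω j) * N j := by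
    rw [hU, ← Finset.sum_add_distrib]
    refine Finset.sum_congr rfl fun j _ => ?_
    by_cases h : F (ω j) ≤ a
    · have h1 : N j = 0 := Set.indicator_of_notMem (s := {ω | a < F ω}) (not_lt.2 h) _
      rw [Set.indicator_of_mem (by exact h), h1]; ring
    · have h1 : N j = 1 := Set.indicator_of_mem (s := {ω | a < F ω}) (not_le.1 h) _
      rw [Set.indicator_of_notMem (by exact h), h1]; ring
  have hN2 : ∀ j, N j ^ 2 = N j := fun j => by
    by_cases h : a < F (ω j)
    · have h1 : N j = 1 := Set.indicator_of_mem (s := {ω | a < F ω}) h _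
      rw [h1]; norm_num
    · have h1 : N j = 0 := Set.indicator_of_notMem (s := {ω | a < F ω}) h _
      rw [h1]; norm_num
  have hUz : 1 / √n * |U| ≤ z := by
    have h1 := hz _ ⟨X, hX, 1, abs_one, rfl⟩
    have h2 := hz _ ⟨X, hX, -1, by simp, rfl⟩
    rw [← Finset.mul_sum] at h1 h2
    rcases abs_cases U with ⟨h, -⟩ | ⟨h, -⟩ <;> rw [h]
    · exact h1
    · refine le_trans (le_of_eq ?_) h2
      rw [← hU]; ring
  have hCS : |∑ j, X (ω j) * N j| ≤ √(∑ j, X (ω j) ^ 2) * √(∑ j, N j) := by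
    have h1 := Finset.sum_mul_sq_le_sq_mul_sq Finset.univ (fun j => X (ω j)) N
    simp_rw [hN2] at h1
    rw [← Real.sqrt_mul (Finset.sum_nonneg fun _ _ => sq_nonneg _)]
    exact Real.abs_le_sqrt h1
  have hV : √(empVar X ω) = 1 / √n * √(∑ j, X (ω j) ^ 2) := by
    rw [empVar, Real.sqrt_mul (by positivity), Real.sqrt_div zero_le_one, Real.sqrt_one]
  rw [sqrt_mul_empMean hn, hsplit, abs_mul, abs_of_pos (by positivity : 0 < 1 / √(n : ℝ)), hV]
  calc 1 / √n * |U + ∑ j, X (ω j) * N j|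
      ≤ 1 / √n * (|U| + √(∑ j, X (ω j) ^ 2) * √(∑ j, N j)) := by
        gcongr
        exact (abs_add_le _ _).trans (by gcongr)
    _ = 1 / √n * |U| + 1 / √n * √(∑ j, X (ω j) ^ 2) * √(∑ j, N j) := by ring
    _ ≤ _ := by gcongr

/-- A vanishing denominator makes the quotient `0`, which cannot exceed `t ≥ 0`; so on the event one
may clear denominators. -/
theorem lt_abs_sqrt_mul_empMean {Ω : Type*} {n : ℕ} {X : Ω → ℝ} {ω : Fin n → Ω} {t : ℝ}
    (ht : 0 ≤ t) (h : t < |√n * selfNorm X ω|) :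
    0 < √(empVar X ω) ∧ t * √(empVar X ω) < |√n * empMean X ω| := by
  have hV : 0 < √(empVar X ω) := by
    refine (Real.sqrt_nonneg _).lt_of_ne fun h0 => ?_
    rw [selfNorm, ← h0] at h
    simp at h
    linarith
  refine ⟨hV, ?_⟩
  rwa [selfNorm, ← mul_div_assoc, abs_div, abs_of_pos hV, lt_div_iff₀ hV] at h

/-- Chernoff's bound for the number of large observations. -/
theorem IsEnveloped.measureReal_count_ge_le (hE : IsEnveloped P 𝔛 F) [IsProbabilityMeasure P]
    (a : ℝ) (n : ℕ) {s k : ℝ} (hs : 0 ≤ s) :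
    (sampleLaw P n).real
        {ω | k ≤ ∑ j, {ω | a < F ω}.indicator (fun _ => (1 : ℝ)) (ω j)} ≤
      Real.exp (n * (Real.exp s * P.real {ω | a < F ω}) - s * k) := by
  set I : Ω → ℝ := {ω | a < F ω}.indicator (fun _ => (1 : ℝ)) with hI
  have hm := hE.measurableSet_gt a
  have hIB : BddMeas I := ⟨measurable_const.indicator hm, 1, fun y => by
    by_cases h : y ∈ {ω | a < F ω}
    · rw [hI, Set.indicator_of_mem h, abs_one]
    · rw [hI, Set.indicator_of_notMem h, abs_zero]; exact zero_le_one⟩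
  have hB : BddMeas fun ω : Fin n → Ω => ∑ j, s * I (ω j) :=
    BddMeas.sum fun j => (BddMeas.const s).mul (hIB.comp (measurable_pi_apply j))
  refine measureReal_le_exp (sampleLaw P n) hB (fun ω hω => ?_)
    ((integral_exp_sum_le P (T := fun y => s * I y)).trans (Real.exp_le_exp.2 ?_))
  · rw [← Finset.mul_sum]
    exact mul_le_mul_of_nonneg_left hω hs
  · gcongr
    have h1 : ∀ y, Real.exp (s * I y) ≤ 1 + Real.exp s * I y := fun y => by
      by_cases h : y ∈ {ω | a < F ω}
      · rw [hI, Set.indicator_of_mem h]; simp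
      · rw [hI, Set.indicator_of_notMem h]; simp
    have h2 := integral_mono (((BddMeas.const s).mul hIB).exp.integrable P)
      (((BddMeas.const 1).add ((BddMeas.const (Real.exp s)).mul hIB)).integrable P) h1
    have hi := ((BddMeas.const (Real.exp s)).mul hIB).integrable P
    rw [integral_add (integrable_const 1) hi, integral_const_mul,
      hI, integral_indicator_const _ hm] at h2
    simp only [integral_const, probReal_univ, smul_eq_mul, mul_one] at h2
    linarith

/-- The empirical second moments are bounded below uniformly over the family. -/
theorem IsEnveloped.measureReal_lower_le (hE : IsEnveloped P 𝔛 F) [IsProbabilityMeasure P]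
    {M δ : ℝ} (n : ℕ) (hδ : 0 < δ) (hτM : tailSq P F M ≤ δ)
    {𝒦 : Finset ((Ω → ℝ) × (Ω → ℝ))}
    (h𝒦 : ∀ p ∈ 𝒦, Measurable p.1 ∧ (∀ ω, 0 ≤ p.1 ω ∧ p.1 ω ≤ F ω ^ 2) ∧
      1 - δ ≤ ∫ ω, p.1 ω ∂P) :
    (sampleLaw P n).real
        (⋃ p ∈ 𝒦, {ω | ∑ j, {ω | F ω ≤ M}.indicator p.1 (ω j) ≤ n * (1 - 2 * δ - δ)}) ≤
      𝒦.card * Real.exp (-(2 * δ ^ 2 / (M ^ 2) ^ 2 * n)) := by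
  refine (measureReal_biUnion_finset_le _ _).trans ((Finset.sum_le_card_nsmul _ _ _
    fun p hp => ?_).trans_eq (nsmul_eq_mul _ _))
  obtain ⟨hpm, hp0, hp1⟩ := h𝒦 p hp
  have hpi : Integrable p.1 P := hE.integrable_of_le hpm fun ω => by
    rw [abs_of_nonneg (hp0 ω).1]; exact (hp0 ω).2
  have hm := hE.measurableSet_le M
  refine measureReal_sum_le_le P (hpm.indicator hm)
    (fun y => Set.indicator_nonneg (fun _ _ => (hp0 _).1) y) (fun y => ?_) ?_ hδ.le
  · refine Set.indicator_apply_le' (fun hy => ?_) fun _ => sq_nonneg _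
    exact (hp0 y).2.trans (pow_le_pow_left₀ (hE.nonneg y) hy 2)
  -- Truncation at `M` costs a further `δ`, so the mean is at least `1 - 2δ`; the last `δ` in the
  -- event is Hoeffding's deviation.
  · have h1 : ∫ y, p.1 y ∂P ≤ ∫ y, ({ω | F ω ≤ M}.indicator p.1 y +
        {ω | M < F ω}.indicator (fun ω => F ω ^ 2) y) ∂P := by
      refine integral_mono hpi ((hpi.indicator hm).add (hE.integrable_tail M)) fun y => ?_
      by_cases h : F y ≤ M
      · have h1 : {ω | F ω ≤ M}.indicator p.1 y = p.1 y :=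
          Set.indicator_of_mem (s := {ω | F ω ≤ M}) h _
        have h2 : 0 ≤ {ω | M < F ω}.indicator (fun ω => F ω ^ 2) y :=
          Set.indicator_nonneg (fun _ _ => sq_nonneg _) y
        show _ ≤ _ + _
        linarith
      · have h1 : {ω | F ω ≤ M}.indicator p.1 y = 0 :=
          Set.indicator_of_notMem (s := {ω | F ω ≤ M}) h _
        have h2 : {ω | M < F ω}.indicator (fun ω => F ω ^ 2) y = F y ^ 2 :=
          Set.indicator_of_mem (s := {ω | M < F ω}) (not_le.1 h) _
        show _ ≤ _ + _
        linarith [(hp0 y).2]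
    rw [integral_add (hpi.indicator hm) (hE.integrable_tail M)] at h1
    have h2 : ∫ y, {ω | M < F ω}.indicator (fun ω => F ω ^ 2) y ∂P ≤ δ := hτM
    linarith

/-- The self-normalized deviation event is covered by a deviation of the majorant `Z`, an atypical
empirical second moment, and an excess of large observations. -/
theorem selfNorm_event_subset {Ω : Type*} {𝔛 : Set (Ω → ℝ)} {F : Ω → ℝ} {a M δ t k : ℝ} {n : ℕ}
    (hn : 0 < n) (hδ : 0 < δ) (hδ1 : 3 * δ ≤ 1) (hk : 0 ≤ k) (hkt : k ≤ t)
    {𝒦 : Finset ((Ω → ℝ) × (Ω → ℝ))} (h𝒦 : ∀ p ∈ 𝒦, ∀ ω, 0 ≤ p.1 ω)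
    (hX𝒦 : ∀ X ∈ 𝔛, ∃ p ∈ 𝒦, ∀ ω, p.1 ω ≤ X ω ^ 2) {Z : (Fin n → Ω) → ℝ}
    (hZ : ∀ h ∈ truncClass 𝔛 F a n, ∀ ω, ∑ j, h (ω j) ≤ Z ω) {t' : ℝ} (ht' : 0 < t')
    (htt' : t < t') :
    {ω : Fin n → Ω | ENNReal.ofReal t' ≤ ⨆ X ∈ 𝔛, ENNReal.ofReal |√n * selfNorm X ω|} ⊆
      {ω | (t - k) * (1 - 3 * δ) ≤ Z ω} ∪
      ((⋃ p ∈ 𝒦, {ω | ∑ j, {ω | F ω ≤ M}.indicator p.1 (ω j) ≤ n * (1 - 2 * δ - δ)}) ∪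
      {ω | k ^ 2 ≤ ∑ j, {ω | a < F ω}.indicator (fun _ => (1 : ℝ)) (ω j)}) := by
  intro ω hω
  have hn' : (0 : ℝ) < n := by exact_mod_cast hn
  -- The supremum need not be attained, so a slightly smaller `t` is used to extract one `X`.
  have hlt : ENNReal.ofReal t < ⨆ X ∈ 𝔛, ENNReal.ofReal |√n * selfNorm X ω| :=
    ((ENNReal.ofReal_lt_ofReal_iff ht').2 htt').trans_le hω
  obtain ⟨X, hlt⟩ := lt_iSup_iff.1 hlt
  obtain ⟨hX, hlt⟩ := lt_iSup_iff.1 hlt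
  have ht : 0 ≤ t := hk.trans hkt
  obtain ⟨hV0, hV⟩ := lt_abs_sqrt_mul_empMean ht (ENNReal.ofReal_lt_ofReal_iff'.1 hlt).1
  by_contra hcon
  simp only [Set.mem_union, not_or] at hcon
  obtain ⟨h1, h2, h3⟩ := hcon
  have h1' : Z ω < (t - k) * (1 - 3 * δ) := not_le.1 fun h => h1 h
  have h3' : ∑ j, {ω | a < F ω}.indicator (fun _ => (1 : ℝ)) (ω j) < k ^ 2 :=
    not_le.1 fun h => h3 h
  obtain ⟨p, hp, hpX⟩ := hX𝒦 X hX
  have h2' : n * (1 - 2 * δ - δ) < ∑ j, {ω | F ω ≤ M}.indicator p.1 (ω j) :=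
    not_le.1 fun h => h2 (Set.mem_biUnion (show p ∈ (𝒦 : Set _) from hp) h)
  have hVl : 1 - 3 * δ ≤ empVar X ω := by
    rw [empVar, one_div_mul_eq_div, le_div_iff₀ hn']
    have : ∑ j, {ω | F ω ≤ M}.indicator p.1 (ω j) ≤ ∑ j, X (ω j) ^ 2 :=
      Finset.sum_le_sum fun j _ =>
        (Set.indicator_le_self' (fun _ _ => h𝒦 p hp _) _).trans (hpX _)
    linarith
  -- A number in `[0, 1]` dominates its square, so no square root of `1 - 3δ` has to be carried.
  have hsV : 1 - 3 * δ ≤ √(empVar X ω) := by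
    refine Real.le_sqrt_of_sq_le ?_
    nlinarith
  have hkN : √(∑ j, {ω | a < F ω}.indicator (fun _ => (1 : ℝ)) (ω j)) ≤ k :=
    Real.sqrt_le_iff.2 ⟨hk, h3'.le⟩
  have hdet := abs_sqrt_mul_empMean_le hn hX (fun h hh => hZ h hh ω)
  have h4 := mul_le_mul_of_nonneg_left hkN hV0.le
  have h5 := mul_le_mul_of_nonneg_left hsV (sub_nonneg.2 hkt)
  linarith

end SelfNorm

/-! ### Choice of the slack. -/

section Constants

/-- At `δ = 0` the last two inequalities are strict: `C < α C`, and the rate limit is `1 / 8` while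
`α ^ 2 > 2`. Continuity in `δ` does the rest. -/
theorem exists_small_slack {α C κ : ℝ} (hα : √2 < α) (hC : 0 < C) (hκ : 0 < κ) :
    ∃ δ : ℝ, 0 < δ ∧ δ < 1 / 10 ∧ C + 4 * δ ≤ α * C * (1 - 3 * δ) ∧
      1 / (4 * α ^ 2 * (1 + κ)) ≤ (1 - 5 * δ) ^ 2 * (1 - δ) / (4 * (2 + 7 * δ)) := by
  have hα2 : 2 < α ^ 2 := by
    rw [← Real.sqrt_lt' ((Real.sqrt_nonneg 2).trans_lt hα)]; exact hα
  have hα1 : 1 < α := lt_of_le_of_lt (Real.one_le_sqrt.2 one_le_two) hα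
  have h1 : Tendsto (fun δ : ℝ => α * C * (1 - 3 * δ) - 4 * δ) (nhds 0)
      (nhds (α * C * (1 - 3 * 0) - 4 * 0)) := Continuous.tendsto (by fun_prop) 0
  have h2 : Tendsto (fun δ : ℝ => (1 - 5 * δ) ^ 2 * (1 - δ) / (4 * (2 + 7 * δ))) (nhds 0)
      (nhds ((1 - 5 * 0) ^ 2 * (1 - 0) / (4 * (2 + 7 * 0)))) := by
    refine Tendsto.div (Continuous.tendsto (by fun_prop) 0)
      (Continuous.tendsto (by fun_prop) 0) (by norm_num)
  have e1 := h1.eventually (lt_mem_nhds (a := C) (by nlinarith))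
  have e2 := h2.eventually (lt_mem_nhds (a := 1 / (4 * α ^ 2 * (1 + κ))) (by
    have : (1 - 5 * 0) ^ 2 * (1 - 0) / (4 * (2 + 7 * 0)) = 1 / (8 : ℝ) := by norm_num
    rw [this]
    refine one_div_lt_one_div_of_lt (by norm_num) ?_
    nlinarith))
  have e3 : ∀ᶠ δ : ℝ in nhds 0, δ < 1 / 10 := gt_mem_nhds (by norm_num)
  obtain ⟨δ, ⟨hδ1, hδ2, hδ3⟩, hδ0⟩ :=
    (((e1.and (e2.and e3)).filter_mono nhdsWithin_le_nhds).and
      (self_mem_nhdsWithin (s := Set.Ioi (0 : ℝ)))).exists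
  exact ⟨δ, hδ0, hδ3, by linarith, hδ2.le⟩

theorem rate_le_one {δ : ℝ} (hδ : 0 < δ) (hδ1 : δ < 1 / 10) :
    (1 - 5 * δ) ^ 2 * (1 - δ) / (4 * (2 + 7 * δ)) ≤ 1 := by
  rw [div_le_one (by positivity)]
  have h1 : (1 - 5 * δ) ^ 2 ≤ 1 := pow_le_one₀ (by linarith) (by linarith)
  have h2 := mul_le_mul_of_nonneg_right h1 (show 0 ≤ 1 - δ by linarith)
  linarith

theorem eventually_mul_exp_neg_le {c B ε : ℝ} (hc : 0 < c) (hε : 0 < ε) :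
    ∀ᶠ n : ℕ in atTop, B * Real.exp (-(c * n)) ≤ ε := by
  have h : Tendsto (fun n : ℕ => B * Real.exp (-(c * n))) atTop (nhds (B * 0)) :=
    (Real.tendsto_exp_neg_atTop_nhds_zero.comp
      (tendsto_natCast_atTop_atTop.const_mul_atTop hc)).const_mul B
  rw [mul_zero] at h
  exact (h.eventually (gt_mem_nhds hε)).mono fun n hn => hn.le

end Constants

/-! ### The tail bound at a fixed sample size. -/

section Tail

variable {Ω : Type*} [MeasurableSpace Ω] {P : Measure Ω} {𝔛 : Set (Ω → ℝ)} {F : Ω → ℝ}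

/-- The tail bound for a fixed sample size and a fixed truncation level `a = η √n / (x + 1)`. -/
theorem IsEnveloped.measureReal_selfNorm_ge_le (hE : IsEnveloped P 𝔛 F) [IsProbabilityMeasure P]
    (hne : 𝔛.Nonempty) {α β δ η C M a x : ℝ} {n : ℕ} (hn : 0 < n) (hδ : 0 < δ) (hδ1 : δ < 1 / 10)
    (hC : 0 < C) (hαC : C + 4 * δ ≤ α * C * (1 - 3 * δ))
    (hβ : β ≤ (1 - 5 * δ) ^ 2 * (1 - δ) / (4 * (2 + 7 * δ))) (hη : 0 < η)
    (hηδ : η ≤ δ) (hM : 0 < M) (hMa : M ≤ a) (hx : 0 < x) (ha : a = η * √n / (x + 1))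
    (hτM : tailSq P F M ≤ δ) (hτa : tailSq P F a ≤ δ * η)
    (hτa' : tailSq P F a ≤ η ^ 2 * Real.exp (-(2 / δ ^ 2)))
    {𝒦 : Finset ((Ω → ℝ) × (Ω → ℝ))}
    (h𝒦 : ∀ p ∈ 𝒦, Measurable p.1 ∧ Measurable p.2 ∧ (∀ ω, 0 ≤ p.1 ω ∧ p.1 ω ≤ F ω ^ 2) ∧
      (∀ ω, 0 ≤ p.2 ω ∧ p.2 ω ≤ F ω ^ 2) ∧ 1 - δ ≤ ∫ ω, p.1 ω ∂P ∧ ∫ ω, p.2 ω ∂P ≤ 1 + δ)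
    (hX𝒦 : ∀ X ∈ 𝔛, ∃ p ∈ 𝒦, ∀ ω, p.1 ω ≤ X ω ^ 2 ∧ X ω ^ 2 ≤ p.2 ω)
    (hout : outerExpectation (sampleLaw P n) (fun ω =>
      ⨆ X ∈ 𝔛, ENNReal.ofReal |√n * empMean X ω|) < ENNReal.ofReal (C + δ))
    (hηc : η ≤ δ ^ 2 / (M ^ 2) ^ 2)
    (hn1 : M ^ 2 * 𝒦.card * Real.exp (-(δ ^ 2 / (M ^ 2) ^ 2 * n)) ≤ δ)
    (hn2 : 𝒦.card * Real.exp (-(δ ^ 2 / (M ^ 2) ^ 2 * n)) ≤ 1 / 2)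
    (hxn : β * x ^ 2 ≤ δ ^ 2 / (M ^ 2) ^ 2 * n) :
    (sampleLaw P n).real {ω | ENNReal.ofReal (x + α * C) ≤
        ⨆ X ∈ 𝔛, ENNReal.ofReal |√n * selfNorm X ω|} ≤ 2 * Real.exp (-(β * x ^ 2)) := by
  set c := δ ^ 2 / (M ^ 2) ^ 2 with hc
  have hn' : (0 : ℝ) < n := by exact_mod_cast hn
  have hsn : 0 < √(n : ℝ) := Real.sqrt_pos.2 hn'
  have hx1 : 0 < x + 1 := by linarith
  have ha0 : 0 < a := hM.trans_le hMa
  have han : a / √n = η / (x + 1) := by rw [ha]; field_simp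
  have h2c : 2 * δ ^ 2 / (M ^ 2) ^ 2 * n = 2 * c * n := by rw [hc]; ring
  have hδ2 : 0 < δ * δ := mul_pos hδ hδ
  have hδx : 0 < δ * x := mul_pos hδ hx
  have hαC0 : 2 * δ ≤ α * C := by
    by_contra! h
    have := mul_lt_mul_of_pos_right h (show 0 < 1 - 3 * δ by linarith)
    linarith
  have hαC1 : 0 ≤ α * C := by linarith
  obtain ⟨Z, hZB, hZH, hZmean, hZexp⟩ := hE.exists_majorant hne hn hM hMa hδ (by linarith) hτM
    (hτa.trans (mul_le_of_le_one_right hδ.le (by linarith))) (fun p hp => ⟨(h𝒦 p hp).2.1, (h𝒦 p hp).2.2.2.1, (h𝒦 p hp).2.2.2.2.2⟩)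
    fun X hX => by
      obtain ⟨p, hp, h⟩ := hX𝒦 X hX
      exact ⟨p, hp, fun ω => (h ω).2⟩
  have hmean := hZmean (C + δ) (by linarith) hout
  -- The truncation bias may grow linearly in `x`, provided its slope is `δ`: it is absorbed by
  -- shrinking `x` to `y` below.
  have hmean' : √n * (tailSq P F a / a) ≤ δ * (x + 1) := by
    have h1 : √n * (tailSq P F a / a) = tailSq P F a / η * (x + 1) := by
      rw [ha]; field_simp
    rw [h1]
    gcongr
    rwa [div_le_iff₀ hη]
  set t := x + α * C - δ with ht
  set k := δ * (x + 1) with hk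
  have hk0 : 0 ≤ k := by positivity
  have hδx1 : δ * x ≤ 1 * x := mul_le_mul_of_nonneg_right (by linarith) hx.le
  have hkt : k ≤ t := by rw [hk, ht]; linarith
  have hsub := selfNorm_event_subset (a := a) (M := M) hn hδ (by linarith) hk0 hkt
    (fun p hp ω => ((h𝒦 p hp).2.2.1 ω).1) (fun X hX => by
      obtain ⟨p, hp, h⟩ := hX𝒦 X hX
      exact ⟨p, hp, fun ω => (h ω).1⟩) hZH (t' := x + α * C) (by linarith) (by linarith)
  have hunion := (measureReal_mono (μ := sampleLaw P n) hsub).trans (measureReal_union_le _ _)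
  have hunion' := hunion.trans (add_le_add_right (measureReal_union_le _ _) _)
  set v := (2 + 7 * δ) / (1 - δ) with hv
  have hv2 : 2 ≤ v := by
    rw [hv, le_div_iff₀ (by linarith)]; linarith
  -- Of the `5δ`, at most `4δ` is lost in `(t - k)(1 - 3δ)` and `δ` in the mean of `Z`; the constant
  -- terms are covered by `hαC`.
  set y := (1 - 5 * δ) * x with hy
  have hy0 : 0 < y := mul_pos (by linarith) hx
  have hyx : y ≤ x := by rw [hy]; linarith
  -- The minimizer of `v L ^ 2 - L y`, with value `-(y ^ 2 / (4 v))`.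
  set L := y / (2 * v) with hL
  have hL0 : 0 < L := by positivity
  have hLx : L ≤ x := by
    refine (div_le_self hy0.le ?_).trans hyx
    linarith
  have hLη : L * (η / (x + 1)) ≤ η := by
    rw [mul_div_assoc', div_le_iff₀ hx1, mul_comm]
    exact mul_le_mul_of_nonneg_left (by linarith) hη.le
  -- As `L ≤ x`, the level `a = η √n / (x + 1)` keeps `L a / √n ≤ η`. Because `η ≤ c`, the growth
  -- factor `e^{L n a / √n}` uses up only half of Hoeffding's exponent `2 c n`.
  have hexp := hZexp L hL0 (by
      rw [han, ← mul_pow]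
      have h0 : 0 ≤ L * (η / (x + 1)) := by positivity
      have h1 := hLη.trans hηδ
      exact (pow_le_of_le_one h0 (by linarith) two_ne_zero).trans h1) (by
      rw [h2c, han]
      have h1 : Real.exp (L * (n * (η / (x + 1)))) * Real.exp (-(2 * c * n)) ≤
          Real.exp (-(c * n)) := by
        rw [← Real.exp_add, Real.exp_le_exp]
        have := mul_le_mul_of_nonneg_left (hLη.trans hηc) hn'.le
        linarith
      calc _ = M ^ 2 * 𝒦.card *
            (Real.exp (L * (n * (η / (x + 1)))) * Real.exp (-(2 * c * n))) := by ring
        _ ≤ M ^ 2 * 𝒦.card * Real.exp (-(c * n)) := by gcongr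
        _ ≤ δ := hn1)
  have hA : (sampleLaw P n).real {ω | (t - k) * (1 - 3 * δ) ≤ Z ω} ≤ Real.exp (-(β * x ^ 2)) := by
    refine (measureReal_le_exp (sampleLaw P n) ((BddMeas.const L).mul hZB)
      (t := L * ((t - k) * (1 - 3 * δ)))
      (fun ω hω => mul_le_mul_of_nonneg_left hω hL0.le) hexp).trans (Real.exp_le_exp.2 ?_)
    have h1 : ∫ ω, Z ω ∂(sampleLaw P n) + y ≤ (t - k) * (1 - 3 * δ) := by
      refine (add_le_add_left (hmean.trans (add_le_add_right hmean' _)) _).trans ?_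
      rw [hy, ht, hk]
      linarith [mul_pos hδ hδx]
    have h2 : v * L ^ 2 - L * y = -(y ^ 2 / (4 * v)) := by
      rw [hL]; field_simp; ring
    have h3 : β * x ^ 2 ≤ y ^ 2 / (4 * v) := by
      have : y ^ 2 / (4 * v) = (1 - 5 * δ) ^ 2 * (1 - δ) / (4 * (2 + 7 * δ)) * x ^ 2 := by
        have : (1 : ℝ) - δ ≠ 0 := by linarith
        rw [hy, hv]; field_simp
      rw [this]
      gcongr
    have h4 := mul_le_mul_of_nonneg_left h1 hL0.le
    linarith
  have hB := hE.measureReal_lower_le n hδ hτM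
    fun p hp => ⟨(h𝒦 p hp).1, (h𝒦 p hp).2.2.1, (h𝒦 p hp).2.2.2.2.1⟩
  have hB' : 𝒦.card * Real.exp (-(2 * δ ^ 2 / (M ^ 2) ^ 2 * n)) ≤
      1 / 2 * Real.exp (-(β * x ^ 2)) := by
    rw [h2c]
    have : Real.exp (-(2 * c * n)) = Real.exp (-(c * n)) * Real.exp (-(c * n)) := by
      rw [← Real.exp_add]; ring_nf
    rw [this, ← mul_assoc]
    gcongr
  -- This `s` makes `s k ^ 2 = 2 (x + 1) ^ 2`, while the mean term is at most `(x + 1) ^ 2` thanks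
  -- to `hτa'`. The net exponent `-(x + 1) ^ 2` is below `-1 - β x ^ 2`, and `e^{-1} ≤ 1 / 2`.
  have hcount := hE.measureReal_count_ge_le a n (s := 2 / δ ^ 2) (k := k ^ 2) (by positivity)
  have hC' : Real.exp (n * (Real.exp (2 / δ ^ 2) * P.real {ω | a < F ω}) - 2 / δ ^ 2 * k ^ 2) ≤
      1 / 2 * Real.exp (-(β * x ^ 2)) := by
    have h1 : n * (Real.exp (2 / δ ^ 2) * P.real {ω | a < F ω}) ≤ (x + 1) ^ 2 := by
      calc n * (Real.exp (2 / δ ^ 2) * P.real {ω | a < F ω})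
          ≤ n * (Real.exp (2 / δ ^ 2) * (η ^ 2 * Real.exp (-(2 / δ ^ 2)) / a ^ 2)) := by
            gcongr
            exact (hE.measureReal_tail_le ha0).trans (by gcongr)
        _ = n * η ^ 2 / a ^ 2 * (Real.exp (2 / δ ^ 2) * Real.exp (-(2 / δ ^ 2))) := by ring
        _ = (x + 1) ^ 2 := by
            rw [← Real.exp_add, add_neg_cancel, Real.exp_zero, mul_one, ha, div_pow, mul_pow,
              Real.sq_sqrt hn'.le]
            field_simp
    have h2 : 2 / δ ^ 2 * k ^ 2 = 2 * (x + 1) ^ 2 := by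
      rw [hk]; field_simp
    have hβ1 := mul_le_mul_of_nonneg_right (hβ.trans (rate_le_one hδ hδ1)) (sq_nonneg x)
    have h3 : Real.exp (-1) ≤ 1 / 2 := by
      rw [Real.exp_neg, ← one_div]
      exact one_div_le_one_div_of_le two_pos (by linarith [Real.add_one_le_exp 1])
    have h4 : Real.exp (n * (Real.exp (2 / δ ^ 2) * P.real {ω | a < F ω}) - 2 / δ ^ 2 * k ^ 2) ≤
        Real.exp (-1) * Real.exp (-(β * x ^ 2)) := by
      rw [← Real.exp_add, Real.exp_le_exp, h2]
      linarith
    exact h4.trans (by gcongr)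
  linarith

end Tail

end SelfNormalized

/-! ### Assembly and choice of the range of `x`. -/

theorem proposition6p1 {Ω : Type*} [MeasurableSpace Ω] (P : Measure Ω) [IsProbabilityMeasure P]
    (𝔛 : Set (Ω → ℝ))
    (hmeas : ∀ X ∈ 𝔛, Measurable X)
    (hcentered : ∀ X ∈ 𝔛, Integrable X P ∧ ∫ ω, X ω ∂P = 0)
    (hnormalized : ∀ X ∈ 𝔛, Integrable (fun ω => X ω ^ 2) P ∧ ∫ ω, X ω ^ 2 ∂P = 1)
    (hbracket : ∀ ε : ℝ, 0 < ε → SelfNormalized.bracketingNumber P 𝔛 ε < ⊤)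
    (C : ℝ) (hC : 0 < C)
    (hlimsup : limsup (fun n : ℕ =>
        SelfNormalized.outerExpectation (SelfNormalized.sampleLaw P n) (fun ω =>
          ⨆ X ∈ 𝔛, ENNReal.ofReal |Real.sqrt n * SelfNormalized.empMean X ω|)) atTop
      ≤ ENNReal.ofReal C) :
    ∀ κ : ℝ, 0 < κ → ∀ α : ℝ, Real.sqrt 2 < α →
      ∃ θ : ℝ, 0 < θ ∧ ∃ n₀ : ℕ, 0 < n₀ ∧ ∀ n : ℕ, n₀ ≤ n →
        ∀ x ∈ Set.Icc (0 : ℝ) (θ * Real.sqrt n),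
          (SelfNormalized.sampleLaw P n).real
              {ω | ENNReal.ofReal (x + α * C) ≤
                ⨆ X ∈ 𝔛, ENNReal.ofReal |Real.sqrt n * SelfNormalized.selfNorm X ω|}
            ≤ 2 * Real.exp (-(x ^ 2 / (4 * α ^ 2 * (1 + κ)))) := by
  intro κ hκ α hα
  have hα0 : 0 < α := (Real.sqrt_nonneg 2).trans_lt hα
  obtain ⟨δ, hδ, hδ1, hαC, hβ⟩ := SelfNormalized.exists_small_slack hα hC hκ
  set β := 1 / (4 * α ^ 2 * (1 + κ)) with hβdef
  have hβ0 : 0 < β := by positivity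
  obtain ⟨F, hFm, hF0, hF2, hXF, 𝒦, h𝒦, hX𝒦⟩ := SelfNormalized.exists_envelope_of_bracketing P
    hmeas hnormalized hbracket hδ (by linarith)
  have hE : SelfNormalized.IsEnveloped P 𝔛 F :=
    ⟨hmeas, hcentered, hnormalized, hFm, hF0, hF2, hXF⟩
  obtain ⟨M₀, hM₀, hτM⟩ := SelfNormalized.exists_forall_integral_tail_le P hFm hF2 hδ
  set M := max M₀ 1 with hM
  have hM1 : 1 ≤ M := le_max_right _ _
  set c := δ ^ 2 / (M ^ 2) ^ 2 with hc
  have hc0 : 0 < c := by positivity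
  have hc1 : c ≤ 1 := by
    rw [hc, div_le_one (by positivity)]
    have : 1 ≤ (M ^ 2) ^ 2 := one_le_pow₀ (one_le_pow₀ hM1)
    nlinarith
  set η := min δ c with hη
  have hη0 : 0 < η := lt_min hδ hc0
  obtain ⟨A₀, hA₀, hτA⟩ := SelfNormalized.exists_forall_integral_tail_le P hFm hF2
    (τ := min (δ * η) (η ^ 2 * Real.exp (-(2 / δ ^ 2)))) (by positivity)
  set A := max A₀ M with hA
  have hA0 : 0 < A := hA₀.trans_le (le_max_left _ _)
  have hout := eventually_lt_of_limsup_lt (hlimsup.trans_lt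
    ((ENNReal.ofReal_lt_ofReal_iff (by linarith)).2 (show C < C + δ by linarith)))
  have e1 := SelfNormalized.eventually_mul_exp_neg_le (B := M ^ 2 * 𝒦.card) hc0 hδ
  have e2 := SelfNormalized.eventually_mul_exp_neg_le (B := 𝒦.card) hc0 (half_pos one_pos)
  have e3 : ∀ᶠ n : ℕ in atTop, 2 * A / η ≤ √(n : ℝ) :=
    (Real.tendsto_sqrt_atTop.comp tendsto_natCast_atTop_atTop).eventually_ge_atTop _
  obtain ⟨n₀, hn₀⟩ := eventually_atTop.1 (hout.and (e1.and (e2.and e3)))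
  -- The first bound on `θ`, with `2 A / η ≤ √n`, keeps the truncation level above `A`, where the
  -- tails of `F` are small. The second makes `β x ^ 2 ≤ c n`, so the Hoeffding errors fit under the
  -- target.
  refine ⟨min (η / (2 * A)) c, by positivity, n₀ + 1, Nat.succ_pos _, fun n hn x hx => ?_⟩
  obtain ⟨ho, h1, h2, h3⟩ := hn₀ n (by omega)
  have hnpos : 0 < n := by omega
  have hx' : x ^ 2 / (4 * α ^ 2 * (1 + κ)) = β * x ^ 2 := by rw [hβdef]; ring
  rw [hx']
  -- At `x = 0` the bound is `2`; the general argument needs `L > 0`.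
  rcases hx.1.eq_or_lt with rfl | hx0
  · refine measureReal_le_one.trans ?_
    norm_num
  rcases 𝔛.eq_empty_or_nonempty with rfl | hne
  · have h4 : 0 < x + α * C := by positivity
    have h5 : {ω : Fin n → Ω | ENNReal.ofReal (x + α * C) ≤ ⨆ X ∈ (∅ : Set (Ω → ℝ)),
        ENNReal.ofReal |√n * SelfNormalized.selfNorm X ω|} = ∅ := by
      refine Set.eq_empty_of_forall_notMem fun ω hω => ?_
      have h6 : ENNReal.ofReal (x + α * C) ≤ ⨆ X ∈ (∅ : Set (Ω → ℝ)),
        ENNReal.ofReal |√n * SelfNormalized.selfNorm X ω| := hω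
      simp at h6
      linarith
    rw [h5, measureReal_empty]
    positivity
  have hAa : A ≤ η * √n / (x + 1) := by
    rw [le_div_iff₀ (by linarith)]
    have h4 : x ≤ η / (2 * A) * √n :=
      hx.2.trans (mul_le_mul_of_nonneg_right (min_le_left _ _) (Real.sqrt_nonneg _))
    have h5 : A * (η / (2 * A) * √n) = η * √n / 2 := by field_simp
    rw [div_le_iff₀ hη0] at h3
    nlinarith [mul_le_mul_of_nonneg_left h4 hA0.le]
  have hτa := hτA _ ((le_max_left A₀ M).trans hAa)
  refine hE.measureReal_selfNorm_ge_le hne hnpos hδ hδ1 hC hαC hβ hη0 (min_le_left _ _)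
    (by positivity) ((le_max_right A₀ M).trans hAa) hx0 rfl (hτM M (le_max_left _ _))
    (hτa.trans (min_le_left _ _)) (hτa.trans (min_le_right _ _)) h𝒦 hX𝒦 ho (min_le_right _ _)
    h1 h2 ?_
  have hβ1 := mul_le_mul_of_nonneg_right (hβ.trans (SelfNormalized.rate_le_one hδ hδ1))
    (sq_nonneg x)
  have h6 : x ≤ c * √n :=
    hx.2.trans (mul_le_mul_of_nonneg_right (min_le_right _ _) (Real.sqrt_nonneg _))
  have h7 : x ^ 2 ≤ c ^ 2 * n := by
    have := pow_le_pow_left₀ hx0.le h6 2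
    rwa [mul_pow, Real.sq_sqrt (Nat.cast_nonneg n)] at this
  have h8 : c ^ 2 * n ≤ c * n := by
    gcongr
    nlinarith
  linarith
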